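/- Setting. Let $X$ (problem statements) and $\Sigma$ (reasoning steps) be sets, let $L,k\ge 1$ be integers, and let all probability distributions be discrete. A verifier is a function $h:X\times\Sigma^*\to\{\mathrm{yes},\mathrm{no}\}$. Given $h$, a trace $\tau=(\tau_1,\dots,\tau_n)$ is correct for $x$ if $h(x,\tau_{1:\ell})=\mathrm{yes}$ for all $1\le\ell\le n$. A prover $P$ assigns to each problem $x$ and partial trace $\tau$ a distribution $P(x,\tau)$ of the next step. A set of provers $\mathcal P=\{P_1,\dots,P_k\}$ is $\alpha$-good for $x$ (with respect to $h$) if for every correct $\tau$ of length $\ell<L$ each of whose steps is produced with positive probability, given the preceding steps, by at least one prover in $\mathcal P$, there is $i\in[k]$ with $\Pr_{s\sim P_i(x,\tau)}[h(x,(\tau,s))=\mathrm{yes}]\ge\alpha$; it is $(\alpha,\gamma)$-good for a distribution $D$ on $X$ if $\Pr_{x\sim D}[\mathcal P\text{ is }\alpha\text{-good for }x]\ge\gamma$. A step-wise online verification algorithm $V_H$ for a class $H$ of verifiers is a function which, given the list of labelled examples seen so far and a new example $(x,\tau_{1:\ell})$, predicts yes or no. It has soundness and completeness mistake bounds $M_s,M_c\in\mathbb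 N$ if for every $h\in H$ and every finite sequence of examples $(x,\tau_{1:\ell})$ with $1\le\ell\le L$ and $\tau_{1:\ell-1}$ correct for $x$ with respect to $h$, labelled by $h(x,\tau_{1:\ell})$, it predicts yes on an example labelled no at most $M_s$ times and no on an example labelled yes at most $M_c$ times. A learning procedure is an adaptive, terminating procedure whose only access to the distribution $D$, the provers $\mathcal P$ and the labelling oracle $\mathcal O=h^*$ is to draw problems $x\sim D$ independently, to sample next steps $s\sim P_j(x,\tau)$, and to query $\mathcal O(x,\tau)$. It outputs a verifier-assisted prover $\widehat P$: a procedure that on input $x$ may only sample next steps from the provers in $\mathcal P$, and then outputs "I don't know" or a trace. Write $\log^+t=\max(1,\log t)$ (the usual convention for logarithms inside $O(\cdot)$). Theorem. There is an absolute constant $C>0$ such that the following holds. Let $V_H$ be a step-wise online verification algorithm for a class $H$ with soundness and completeness mistake bounds $M_s$ and $M_c$, where $M:=M_s+M_c\ge 1$. Let $\alpha\in(0,1]$ and $\epsilon,\epsilon',\delta\in(0,1)$, and put $\epsilon_c=\epsilon M_c/(M_c+M_s)$ and $\epsilon_s=\epsilon M_s/(M_c+M_s)$. There is a learning procedure, depending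 only on $X,\Sigma,L,k,H,V_H,M_s,M_c,\alpha,\epsilon,\epsilon',\delta$, that on every execution draws at most $$C\left(\frac{M}{\epsilon}+\frac1\epsilon\cdot\frac{M}{\min(M_s,M_c)+1}\,\log^+\frac{M}{\delta}\right)$$ problems and makes at most $$C\cdot\frac{M}{\epsilon}\cdot\frac{M}{\min(M_s,M_c)+1}\cdot\log^+\frac{M}{\delta}\cdot\frac{Lk}{\alpha}\,\log^+\frac{Lk}{\epsilon'}$$ calls to the labelling oracle, and such that for every distribution $D$ on $X$, every $h^*\in H$, every $\gamma$, and every set $\mathcal P$ of $k$ provers that is $(\alpha,\gamma)$-good for $D$ with respect to $\mathcal O=h^*$, with probability at least $1-\delta$ the output $\widehat P$ satisfies: 1. given any problem $x\in X$, $\widehat P$ outputs either "I don't know" or a trace of length $L$; 2. the probability, over $x\sim D$ and the sampling of the provers, that $\widehat P$ outputs "I don't know" is at most $(1-\gamma)+\epsilon_c+\epsilon_s+\epsilon'$; 3. the probability, over $x\sim D$ and the sampling of the provers, that $\widehat P$ outputs a trace that is not correct for $x$ with respect to $h^*$ is at most $\epsilon_s$. -/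

import Mathlib

universe u v w

namespace CoTVerification

/-- A verifier `X × S^* → {yes, no}`: `h x τ = true` says that the last step of `τ` is a valid
inference for the problem `x`, assuming that the preceding steps are correct.
Its value on the empty trace is never used. -/
abbrev Verifier (X : Type u) (S : Type v) := X → List S → Bool

/-- A prover: for a problem and a partial trace, a distribution of the next step. -/
abbrev Prover (X : Type u) (S : Type v) := X → List S → PMF S

/-- A (deterministic) online step-wise verification algorithm: from the labelled examples seen so
far, oldest first, and a new example `(x, τ_{1:ℓ})`, it predicts whether the last step of
`τ_{1:ℓ}` is correct. -/
abbrev OnlineVerifier (X : Type u) (S : Type v) :=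
  List ((X × List S) × Bool) → X × List S → Bool

/-- The probability of the event `E` under the discrete distribution `p`. -/
noncomputable def prob {β : Type w} (p : PMF β) (E : Set β) : ℝ :=
  (p.toOuterMeasure E).toReal

section Correctness

variable {X : Type u} {S : Type v}

/-- Every step of `τ` is correct: the oracle `h` says yes on every nonempty prefix. -/
def CorrectTrace (h : Verifier X S) (x : X) (τ : List S) : Prop :=
  ∀ l : ℕ, 1 ≤ l → l ≤ τ.length → h x (τ.take l) = true

/-- A legal example of prefix verification: a trace of length between `1` and `L`
all of whose steps but possibly the last are correct. -/
def LegalExample (h : Verifier X S) (L : ℕ) (z : X × List S) : Prop :=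
  z.2 ≠ [] ∧ z.2.length ≤ L ∧ CorrectTrace h z.1 z.2.dropLast

/-- The number of soundness mistakes (predicting yes when the label is no) that `V`, having seen
`hist`, makes on the examples `zs` labelled by `h`. -/
def soundnessMistakes (V : OnlineVerifier X S) (h : Verifier X S) :
    List ((X × List S) × Bool) → List (X × List S) → ℕ
  | _, [] => 0
  | hist, z :: zs =>
      (if V hist z = true ∧ h z.1 z.2 = false then 1 else 0) +
        soundnessMistakes V h (hist ++ [(z, h z.1 z.2)]) zs

/-- The number of completeness mistakes (predicting no when the label is yes) that `V`, having seen
`hist`, makes on the examples `zs` labelled by `h`. -/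
def completenessMistakes (V : OnlineVerifier X S) (h : Verifier X S) :
    List ((X × List S) × Bool) → List (X × List S) → ℕ
  | _, [] => 0
  | hist, z :: zs =>
      (if V hist z = false ∧ h z.1 z.2 = true then 1 else 0) +
        completenessMistakes V h (hist ++ [(z, h z.1 z.2)]) zs

/-- `V` has step-wise soundness and completeness mistake bounds `Ms` and `Mc` for the class `H`:
they hold on every finite sequence of legal examples labelled by any verifier of `H`. -/
def HasMistakeBounds (V : OnlineVerifier X S) (H : Set (Verifier X S)) (L Ms Mc : ℕ) : Prop :=
  ∀ h ∈ H, ∀ zs : List (X × List S), (∀ z ∈ zs, LegalExample h L z) →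
    soundnessMistakes V h [] zs ≤ Ms ∧ completenessMistakes V h [] zs ≤ Mc

/-- `τ` can be generated for `x` by the provers `P`: each of its steps is produced, with positive
probability given the preceding steps, by at least one of the provers. -/
def Generated {k : ℕ} (P : Fin k → Prover X S) (x : X) (τ : List S) : Prop :=
  ∀ (n : ℕ) (hn : n < τ.length), ∃ j, τ[n] ∈ (P j x (τ.take n)).support

/-- The set of provers `P` is `α`-good for the problem `x` with respect to the oracle `h`. -/
def GoodOn {k : ℕ} (P : Fin k → Prover X S) (h : Verifier X S) (L : ℕ) (α : ℝ) (x : X) : Prop :=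
  ∀ τ : List S, τ.length < L → Generated P x τ → CorrectTrace h x τ →
    ∃ j, α ≤ prob (P j x τ) {s | h x (τ ++ [s]) = true}

/-- The set of provers `P` is `(α, γ)`-good for the distribution `D` over problems. -/
def GoodFor {k : ℕ} (P : Fin k → Prover X S) (h : Verifier X S) (L : ℕ) (α γ : ℝ)
    (D : PMF X) : Prop :=
  γ ≤ prob D {x | GoodOn P h L α x}

end Correctness

/-- A terminating procedure whose only access to the outside is to sample next steps from `k`
provers. -/
inductive ProverProgram (X : Type u) (S : Type v) (k : ℕ) (R : Type w) : Type (max u v w)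
  | output (r : R) : ProverProgram X S k R
  | callProver (j : Fin k) (x : X) (τ : List S) (next : S → ProverProgram X S k R) :
      ProverProgram X S k R

/-- The distribution of the output when the provers are `P`. -/
noncomputable def ProverProgram.law {X : Type u} {S : Type v} {k : ℕ} {R : Type w}
    (P : Fin k → Prover X S) : ProverProgram X S k R → PMF R
  | .output r => PMF.pure r
  | .callProver j x τ next => (P j x τ).bind fun s => (next s).law P

/-- A verifier-assisted prover: on a problem it runs a procedure that may call the `k` provers, and
outputs `none` ("I don't know") or a reasoning trace. -/
abbrev AssistedProver (X : Type u) (S : Type v) (k : ℕ) :=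
  X → ProverProgram X S k (Option (List S))

/-- The joint distribution of a problem `x ∼ D` and the output on `x` of the assisted prover `W`. -/
noncomputable def AssistedProver.jointLaw {X : Type u} {S : Type v} {k : ℕ}
    (W : AssistedProver X S k) (P : Fin k → Prover X S) (D : PMF X) :
    PMF (X × Option (List S)) :=
  D.bind fun x => ((W x).law P).map fun o => (x, o)

/-- A terminating, adaptive learning procedure with result in `R`. Its only access to the problem
distribution, to the provers and to the labelling oracle is: to draw a problem; to sample a next
step from one of the provers; to ask the oracle for the label of a trace. -/
inductive Learner (X : Type u) (S : Type v) (k : ℕ) (R : Type w) : Type (max u v w)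
  | output (r : R) : Learner X S k R
  | drawProblem (next : X → Learner X S k R) : Learner X S k R
  | callProver (j : Fin k) (x : X) (τ : List S) (next : S → Learner X S k R) : Learner X S k R
  | queryOracle (x : X) (τ : List S) (next : Bool → Learner X S k R) : Learner X S k R

namespace Learner

variable {X : Type u} {S : Type v} {k : ℕ} {R : Type w}

/-- The distribution of the result when problems are drawn independently from `D`, the provers
are `P` and the oracle is `h`. -/
noncomputable def law (D : PMF X) (P : Fin k → Prover X S) (h : Verifier X S) :
    Learner X S k R → PMF R
  | .output r => PMF.pure r
  | .drawProblem next => D.bind fun x => (next x).law D P h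
  | .callProver j x τ next => (P j x τ).bind fun s => (next s).law D P h
  | .queryOracle x τ next => (next (h x τ)).law D P h

/-- On every execution path at most `n` problems are drawn. -/
def DrawsAtMost : Learner X S k R → ℕ → Prop
  | .output _, _ => True
  | .drawProblem _, 0 => False
  | .drawProblem next, n + 1 => ∀ x, (next x).DrawsAtMost n
  | .callProver _ _ _ next, n => ∀ s, (next s).DrawsAtMost n
  | .queryOracle _ _ next, n => ∀ b, (next b).DrawsAtMost n

/-- On every execution path the oracle is called at most `n` times. -/
def QueriesAtMost : Learner X S k R → ℕ → Prop
  | .output _, _ => True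
  | .drawProblem next, n => ∀ x, (next x).QueriesAtMost n
  | .callProver _ _ _ next, n => ∀ s, (next s).QueriesAtMost n
  | .queryOracle _ _ _, 0 => False
  | .queryOracle _ _ next, n + 1 => ∀ b, (next b).QueriesAtMost n

end Learner

/-- The logarithm inside an `O(·)`: `max 1 (log t)`, so that the bounds do not degenerate
when the argument is close to `1`. -/
noncomputable def logO (t : ℝ) : ℝ := max 1 (Real.log t)

end CoTVerification

open scoped ENNReal

namespace CoTVerification

/-! The learned prover is a layered search: it extends the trace one step at a time, sampling every
prover `N` times and keeping the first candidate that the current verifier accepts. If it returns an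
incorrect trace, its transcript contains a false acceptance. If it gives up on a good problem, the
transcript contains a misclassified legal example, or some layer drew no correct step, which has
total probability at most `L * (1 - α) ^ N` (`search_none_le`). So it suffices to find a verifier
whose two mistake probabilities are small (`prob_incorrect_le`, `prob_none_le`).

Training is conservative: `V` is shown only legal examples on which it errs, at most one per
problem. Hence histories respect the mistake budgets (`ErrorHistory.errorCount_le`), and the
verifiers met are given by the at most `Ms + Mc + 1` prefixes of the final history. Write `M = Ms +
Mc`, let `M_b` be the budget for mistakes of kind `b`, and put `B_b = max 1 M_b`, `μ = min_b B_b`,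
`θ_b = ε B_b / M`, `w_b = μ / B_b`. The potential is the exponential of the remaining budgets
weighted by `w_b`. It starts at most at `exp (2μ)` and never drops below `1`. Since `w_b θ_b = με /
M` does not depend on `b`, whenever the current verifier errs with probability above `θ_b / 4` for
some kind, the expected potential shrinks by a factor `1 - με / (8M)`. So the probability that no
prefix is good after `n₁` problems is at most `exp (2μ) * (1 - με / (8M)) ^ n₁`
(`train_failure_le`), and `n₁` of order `M / ε + M / (με) * log (1 / δ)` suffices.

A good prefix is then found by testing all prefixes on the same `n₂` fresh problems. Chernoff bounds
separate `θ_b / 4` from `θ_b` (`misleadingCounts_le`), and the union bound over the candidates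
accounts for `log (M / δ)`. Sharing the problems means that the factor `M + 1` is paid in oracle
calls, not in draws. -/

/-- The expectation of a nonnegative function under a discrete distribution. -/
noncomputable def expect {β : Type*} (p : PMF β) (f : β → ℝ≥0∞) : ℝ≥0∞ := ∑' a, p a * f a

/-! ### Expectations and probabilities of discrete distributions. -/

section Expectation

variable {β γ : Type*}

theorem expect_mono_support {p : PMF β} {f g : β → ℝ≥0∞} (hfg : ∀ a ∈ p.support, f a ≤ g a) :
    expect p f ≤ expect p g := by
  refine ENNReal.tsum_le_tsum fun a => ?_
  by_cases ha : a ∈ p.support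
  · exact mul_le_mul_right (hfg a ha) _
  · rw [PMF.mem_support_iff, not_not] at ha
    simp [ha]

theorem expect_mono {p : PMF β} {f g : β → ℝ≥0∞} (hfg : ∀ a, f a ≤ g a) :
    expect p f ≤ expect p g :=
  expect_mono_support fun a _ => hfg a

theorem expect_const (p : PMF β) (c : ℝ≥0∞) : expect p (fun _ => c) = c := by
  simp [expect, ENNReal.tsum_mul_right, p.tsum_coe]

theorem expect_add (p : PMF β) (f g : β → ℝ≥0∞) :
    expect p (fun a => f a + g a) = expect p f + expect p g := by
  simp [expect, mul_add, ENNReal.tsum_add]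

theorem expect_mul_left (p : PMF β) (c : ℝ≥0∞) (f : β → ℝ≥0∞) :
    expect p (fun a => c * f a) = c * expect p f := by
  simp [expect, ← ENNReal.tsum_mul_left, mul_left_comm]

theorem expect_mul_right (p : PMF β) (f : β → ℝ≥0∞) (c : ℝ≥0∞) :
    expect p (fun a => f a * c) = expect p f * c := by
  simp [expect, ← ENNReal.tsum_mul_right, mul_assoc]

theorem expect_pure (a : β) (f : β → ℝ≥0∞) : expect (PMF.pure a) f = f a := by
  rw [expect, tsum_eq_single a]
  · simp
  · intro b hb
    simp [PMF.pure_apply, hb]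

theorem expect_bind (p : PMF β) (q : β → PMF γ) (f : γ → ℝ≥0∞) :
    expect (p.bind q) f = expect p fun a => expect (q a) f := by
  simp only [expect, PMF.bind_apply, ← ENNReal.tsum_mul_left, ← ENNReal.tsum_mul_right]
  rw [ENNReal.tsum_comm]
  simp [mul_assoc]

theorem expect_map (p : PMF β) (g : β → γ) (f : γ → ℝ≥0∞) :
    expect (p.map g) f = expect p fun a => f (g a) := by
  rw [← PMF.bind_pure_comp, expect_bind]
  simp [expect_pure]

theorem expect_list_sum {ι : Type*} (p : PMF β) (l : List ι) (f : ι → β → ℝ≥0∞) :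
    expect p (fun a => (l.map fun i => f i a).sum) = (l.map fun i => expect p (f i)).sum := by
  induction l with
  | nil => simp [expect_const]
  | cons i l ih => simp [expect_add, ih]

theorem toOuterMeasure_eq_expect (p : PMF β) (s : Set β) :
    p.toOuterMeasure s = expect p (s.indicator 1) := by
  classical
  rw [PMF.toOuterMeasure_apply, expect]
  refine tsum_congr fun a => ?_
  by_cases ha : a ∈ s <;> simp [ha]

theorem toOuterMeasure_bind (p : PMF β) (q : β → PMF γ) (s : Set γ) :
    (p.bind q).toOuterMeasure s = expect p fun a => (q a).toOuterMeasure s :=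
  PMF.toOuterMeasure_bind_apply p q s

theorem toOuterMeasure_le_one (p : PMF β) (s : Set β) : p.toOuterMeasure s ≤ 1 := by
  rw [toOuterMeasure_eq_expect, ← expect_const p 1]
  exact expect_mono fun a => Set.indicator_le_self _ _ a

theorem toOuterMeasure_ne_top (p : PMF β) (s : Set β) : p.toOuterMeasure s ≠ ∞ :=
  ne_top_of_le_ne_top ENNReal.one_ne_top (toOuterMeasure_le_one p s)

theorem toOuterMeasure_add_compl (p : PMF β) (s : Set β) :
    p.toOuterMeasure s + p.toOuterMeasure sᶜ = 1 := by
  rw [toOuterMeasure_eq_expect, toOuterMeasure_eq_expect, ← expect_add, ← expect_const p 1]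
  congr 1
  funext a
  by_cases ha : a ∈ s <;> simp [ha]

theorem toOuterMeasure_mono_support {p : PMF β} {s t : Set β}
    (hst : ∀ a ∈ p.support, a ∈ s → a ∈ t) : p.toOuterMeasure s ≤ p.toOuterMeasure t :=
  PMF.toOuterMeasure_mono p fun a ha => hst a ha.2 ha.1

theorem toOuterMeasure_eq_zero {p : PMF β} {s : Set β} (hs : ∀ a ∈ p.support, a ∉ s) :
    p.toOuterMeasure s = 0 :=
  (PMF.toOuterMeasure_apply_eq_zero_iff p s).2 (Set.disjoint_left.2 hs)

/-- The first-moment (Markov) bound. -/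
theorem toOuterMeasure_le_expect {p : PMF β} {s : Set β} {f : β → ℝ≥0∞}
    (hf : ∀ a ∈ s, 1 ≤ f a) : p.toOuterMeasure s ≤ expect p f := by
  rw [toOuterMeasure_eq_expect]
  refine expect_mono fun a => ?_
  by_cases ha : a ∈ s
  · simpa [ha] using hf a ha
  · simp [ha]

theorem prob_nonneg (p : PMF β) (s : Set β) : 0 ≤ prob p s := ENNReal.toReal_nonneg

theorem ofReal_prob (p : PMF β) (s : Set β) : ENNReal.ofReal (prob p s) = p.toOuterMeasure s :=
  ENNReal.ofReal_toReal (toOuterMeasure_ne_top p s)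

theorem prob_compl (p : PMF β) (s : Set β) : prob p sᶜ = 1 - prob p s := by
  have := congrArg ENNReal.toReal (toOuterMeasure_add_compl p s)
  rw [ENNReal.toReal_add (toOuterMeasure_ne_top p s) (toOuterMeasure_ne_top p sᶜ)] at this
  simp only [prob, ENNReal.toReal_one] at this ⊢
  linarith

-- The one-problem moment computation shared by training (the expected factor of the potential) and
-- validation (the moment generating function of the mistake count).
open Classical in
theorem expect_ite (p : PMF β) (s : Set β) {y : ℝ} (hy : 0 ≤ y) :
    expect p (fun a => ENNReal.ofReal (if a ∈ s then y else 1)) =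
      ENNReal.ofReal (1 + (y - 1) * prob p s) := by
  have h1 : (fun a => ENNReal.ofReal (if a ∈ s then y else 1)) =
      fun a => ENNReal.ofReal y * s.indicator 1 a + sᶜ.indicator 1 a := by
    funext a
    by_cases ha : a ∈ s <;> simp [ha]
  rw [h1, expect_add, expect_mul_left, ← toOuterMeasure_eq_expect, ← toOuterMeasure_eq_expect,
    ← ofReal_prob, ← ofReal_prob, ← ENNReal.ofReal_mul hy,
    ← ENNReal.ofReal_add (mul_nonneg hy (prob_nonneg _ _)) (prob_nonneg _ _), prob_compl]
  congr 1
  ring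

end Expectation

/-! ### Prover programs, and the sampling of one layer. -/

namespace ProverProgram

variable {X : Type u} {S : Type v} {k : ℕ} {R R' : Type*}

/-- Sequential composition. -/
def bind : ProverProgram X S k R → (R → ProverProgram X S k R') → ProverProgram X S k R'
  | .output r, f => f r
  | .callProver j x τ next, f => .callProver j x τ fun s => (next s).bind f

theorem law_bind (P : Fin k → Prover X S) (A : ProverProgram X S k R)
    (f : R → ProverProgram X S k R') :
    (A.bind f).law P = (A.law P).bind fun r => (f r).law P := by
  induction A with
  | output r => simp [bind, law]
  | callProver j x τ next ih => simp [bind, law, ih]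

/-- Every output on every execution path satisfies `Φ`. -/
def AllOutputs (Φ : R → Prop) : ProverProgram X S k R → Prop
  | .output r => Φ r
  | .callProver _ _ _ next => ∀ s, (next s).AllOutputs Φ

theorem AllOutputs.mono {Φ Ψ : R → Prop} (h : ∀ r, Φ r → Ψ r) {A : ProverProgram X S k R}
    (hA : A.AllOutputs Φ) : A.AllOutputs Ψ := by
  induction A with
  | output r => exact h r hA
  | callProver j x τ next ih => exact fun s => ih s (hA s)

theorem AllOutputs.bind {Φ : R → Prop} {Ψ : R' → Prop} {A : ProverProgram X S k R}
    {f : R → ProverProgram X S k R'} (hA : A.AllOutputs Φ)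
    (hf : ∀ r, Φ r → (f r).AllOutputs Ψ) : (A.bind f).AllOutputs Ψ := by
  induction A with
  | output r => exact hf r hA
  | callProver j x τ next ih => exact fun s => ih s (hA s)

theorem AllOutputs.of_mem_support {Φ : R → Prop} {A : ProverProgram X S k R}
    (hA : A.AllOutputs Φ) {P : Fin k → Prover X S} {r : R} (hr : r ∈ (A.law P).support) : Φ r := by
  induction A with
  | output r' =>
    simp only [law, PMF.support_pure, Set.mem_singleton_iff] at hr
    exact hr ▸ hA
  | callProver j x τ next ih =>
    simp only [law, PMF.mem_support_bind_iff] at hr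
    obtain ⟨s, -, hs⟩ := hr
    exact ih s (hA s) hs

/-- Sample one next step from each prover of a list. -/
def sampleSteps (x : X) (τ : List S) : List (Fin k) → ProverProgram X S k (List S)
  | [] => .output []
  | j :: js => .callProver j x τ fun s => (sampleSteps x τ js).bind fun cs => .output (s :: cs)

theorem allOutputs_sampleSteps_length (x : X) (τ : List S) (js : List (Fin k)) :
    (sampleSteps x τ js).AllOutputs fun cs => cs.length = js.length := by
  induction js with
  | nil => simp [sampleSteps, AllOutputs]
  | cons j js ih =>
    intro s
    exact ih.bind fun cs hcs => by simp [AllOutputs, hcs]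

theorem exists_mem_support_of_sampleSteps {P : Fin k → Prover X S} {x : X} {τ : List S}
    {js : List (Fin k)} {cs : List S} (hcs : cs ∈ ((sampleSteps x τ js).law P).support)
    {s : S} (hs : s ∈ cs) : ∃ j, s ∈ (P j x τ).support := by
  induction js generalizing cs with
  | nil =>
    simp only [sampleSteps, law, PMF.support_pure, Set.mem_singleton_iff] at hcs
    simp [hcs] at hs
  | cons j js ih =>
    simp only [sampleSteps, law, law_bind, PMF.mem_support_bind_iff, PMF.support_pure,
      Set.mem_singleton_iff] at hcs
    obtain ⟨s', hs', cs', hcs', rfl⟩ := hcs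
    rcases List.mem_cons.1 hs with rfl | hs
    · exact ⟨j, hs'⟩
    · exact ih hcs' hs

/-- Only the samples from prover `j` are used: they are independent and each misses `G` with
probability at most `1 - α`. The other samples are bounded by probability one. -/
theorem sampleSteps_miss_le {P : Fin k → Prover X S} {x : X} {τ : List S} {G : Set S} {α : ℝ}
    (hα : α ≤ 1) {j : Fin k} (hj : α ≤ prob (P j x τ) G) (js : List (Fin k)) :
    ((sampleSteps x τ js).law P).toOuterMeasure {cs | ∀ s ∈ cs, s ∉ G} ≤
      ENNReal.ofReal ((1 - α) ^ js.count j) := by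
  induction js with
  | nil => simpa using toOuterMeasure_le_one _ _
  | cons i js ih =>
    set c := ENNReal.ofReal ((1 - α) ^ js.count j)
    simp only [sampleSteps, law, law_bind, toOuterMeasure_bind]
    have key : ∀ s, expect ((sampleSteps x τ js).law P) (fun cs =>
        (PMF.pure (s :: cs)).toOuterMeasure {cs | ∀ s ∈ cs, s ∉ G}) ≤ Gᶜ.indicator 1 s * c := by
      intro s
      by_cases hs : s ∈ G
      · rw [← toOuterMeasure_bind, toOuterMeasure_eq_zero]
        · exact zero_le
        · intro cs hcs hcs'
          simp only [PMF.mem_support_bind_iff, PMF.support_pure, Set.mem_singleton_iff] at hcs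
          obtain ⟨cs', -, rfl⟩ := hcs
          exact hcs' s (by simp) hs
      · have : s ∈ Gᶜ := hs
        rw [Set.indicator_of_mem this, Pi.one_apply, one_mul]
        refine le_trans (le_of_eq ?_) ih
        rw [toOuterMeasure_eq_expect]
        congr 1
        funext cs
        have hiff : s :: cs ∈ {cs : List S | ∀ s ∈ cs, s ∉ G} ↔ cs ∈ {cs | ∀ s ∈ cs, s ∉ G} := by
          simp [hs]
        by_cases hc : cs ∈ {cs | ∀ s ∈ cs, s ∉ G}
        · rw [PMF.toOuterMeasure_pure_apply, if_pos (hiff.2 hc), Set.indicator_of_mem hc,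
            Pi.one_apply]
        · rw [PMF.toOuterMeasure_pure_apply, if_neg (mt hiff.1 hc), Set.indicator_of_notMem hc]
    refine (expect_mono key).trans ?_
    rw [expect_mul_right, ← toOuterMeasure_eq_expect]
    by_cases hij : i = j
    · subst hij
      rw [List.count_cons_self, pow_succ, mul_comm _ (1 - α),
        ENNReal.ofReal_mul (by linarith), ← ofReal_prob, prob_compl]
      gcongr
    · rw [List.count_cons_of_ne (by simpa using hij)]
      exact (mul_le_mul_left (toOuterMeasure_le_one _ _) _).trans_eq (one_mul _)

end ProverProgram

/-! ### Mistakes visible on a transcript. -/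

section Mistakes

variable {S : Type v}

/-- `σ` belongs to the transcript `T`, is a legal example of length at most `L`, all of whose
proper prefixes are in `T`, and is misclassified as `b` by `v`, where `h` is the true labelling. -/
def Mistake (L : ℕ) (v h : List S → Bool) (T : List (List S)) (b : Bool) (σ : List S) : Prop :=
  σ ∈ T ∧ σ ≠ [] ∧ σ.length ≤ L ∧ v σ = b ∧ h σ = !b ∧
    ∀ l, 1 ≤ l → l < σ.length → σ.take l ∈ T ∧ h (σ.take l) = true

theorem Mistake.mono {L : ℕ} {v h : List S → Bool} {T T' : List (List S)} {b : Bool} {σ : List S}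
    (hσ : Mistake L v h T b σ) (hT : T ⊆ T') : Mistake L v h T' b σ :=
  ⟨hT hσ.1, hσ.2.1, hσ.2.2.1, hσ.2.2.2.1, hσ.2.2.2.2.1, fun l h1 h2 =>
    ⟨hT (hσ.2.2.2.2.2 l h1 h2).1, (hσ.2.2.2.2.2 l h1 h2).2⟩⟩

/-- A mistake consults the labelling only on members of the transcript, so it can be recognised from
the oracle's answers there. -/
theorem Mistake.congr {L : ℕ} {v h h' : List S → Bool} {T : List (List S)}
    (hh : ∀ σ ∈ T, h σ = h' σ) : Mistake L v h T = Mistake L v h' T := by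
  funext b σ
  refine propext (and_congr_right fun hT => ?_)
  rw [hh σ hT]
  refine and_congr_right' <| and_congr_right' <| and_congr_right' <| and_congr_right' ?_
  refine forall_congr' fun l => forall_congr' fun _ => forall_congr' fun _ =>
    and_congr_right fun hl => ?_
  rw [hh _ hl]

/-- The steps of `τ` are labelled yes by `h`, and its nonempty prefixes are in `T`. -/
def Vouched (h : List S → Bool) (T : List (List S)) (τ : List S) : Prop :=
  ∀ l, 1 ≤ l → l ≤ τ.length → τ.take l ∈ T ∧ h (τ.take l) = true

theorem Vouched.snoc {h : List S → Bool} {T T' : List (List S)} {τ : List S} {s : S}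
    (hτ : Vouched h T τ) (hT : T ⊆ T') (hs : τ ++ [s] ∈ T') (hh : h (τ ++ [s]) = true) :
    Vouched h T' (τ ++ [s]) := by
  intro l h1 h2
  rw [List.length_append, List.length_singleton] at h2
  rcases Nat.lt_or_ge τ.length l with hl | hl
  · rw [List.take_of_length_le (by simpa using hl)]
    exact ⟨hs, hh⟩
  · rw [List.take_append_of_le_length hl]
    exact ⟨hT (hτ l h1 hl).1, (hτ l h1 hl).2⟩

theorem Vouched.mistake_snoc {L : ℕ} {v h : List S → Bool} {T T' : List (List S)} {τ : List S}
    {s : S} {b : Bool} (hτ : Vouched h T τ) (hT : T ⊆ T') (hs : τ ++ [s] ∈ T')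
    (hL : τ.length < L) (hv : v (τ ++ [s]) = b) (hh : h (τ ++ [s]) = !b) :
    Mistake L v h T' b (τ ++ [s]) := by
  refine ⟨hs, by simp, by simpa using hL, hv, hh, fun l h1 h2 => ?_⟩
  rw [List.length_append, List.length_singleton] at h2
  rw [List.take_append_of_le_length (by lia)]
  exact ⟨hT (hτ l h1 (by lia)).1, (hτ l h1 (by lia)).2⟩

end Mistakes

/-! ### The layered search and the ways it can fail. -/

namespace ProverProgram

variable {X : Type u} {S : Type v} {k : ℕ}

/-- Extend `τ` by `n` steps, each of them the first step accepted by `v` among samples from the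
provers `js`; return all the traces considered, and the final trace if every layer succeeded. -/
def search (v : List S → Bool) (x : X) (js : List (Fin k)) :
    ℕ → List S → List (List S) → ProverProgram X S k (List (List S) × Option (List S))
  | 0, τ, T => .output (T, some τ)
  | n + 1, τ, T => (sampleSteps x τ js).bind fun cs =>
      match cs.find? fun s => v (τ ++ [s]) with
      | none => .output (T ++ cs.map fun s => τ ++ [s], none)
      | some s => search v x js n (τ ++ [s]) (T ++ cs.map fun s => τ ++ [s])

variable (v : List S → Bool) (x : X) (js : List (Fin k))

theorem allOutputs_search_subset (n : ℕ) (τ : List S) (T : List (List S)) :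
    (search v x js n τ T).AllOutputs fun r => T ⊆ r.1 := by
  induction n generalizing τ T with
  | zero => exact fun _ h => h
  | succ n ih =>
    refine (allOutputs_sampleSteps_length x τ js).bind fun cs _ => ?_
    split
    · exact List.subset_append_left _ _
    · exact (ih _ _).mono fun r hr => List.Subset.trans (List.subset_append_left _ _) hr

theorem allOutputs_search_length (n : ℕ) (τ : List S) (T : List (List S)) :
    (search v x js n τ T).AllOutputs fun r => r.1.length ≤ T.length + n * js.length := by
  induction n generalizing τ T with
  | zero => simp [search, AllOutputs]
  | succ n ih =>
    refine (allOutputs_sampleSteps_length x τ js).bind fun cs hcs => ?_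
    split
    · simp only [AllOutputs, List.length_append, List.length_map, hcs]
      nlinarith
    · refine (ih _ _).mono fun r hr => hr.trans ?_
      simp only [List.length_append, List.length_map, hcs]
      nlinarith

theorem allOutputs_search_output (n : ℕ) (τ : List S) (T : List (List S)) :
    (search v x js n τ T).AllOutputs fun r =>
      r.2 = none ∨ ∃ σ : List S, σ.length = τ.length + n ∧ r.2 = some σ := by
  induction n generalizing τ T with
  | zero => exact Or.inr ⟨τ, rfl, rfl⟩
  | succ n ih =>
    refine (allOutputs_sampleSteps_length x τ js).bind fun cs _ => ?_
    split
    · exact Or.inl rfl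
    · refine (ih _ _).mono fun r hr => ?_
      simpa [Nat.add_assoc, Nat.add_comm 1] using hr

/-- At the first incorrect step that the search accepts, the preceding trace is still vouched for.
That step is thus a legal example on which the verifier wrongly said yes, and later layers only
enlarge the transcript. -/
theorem allOutputs_search_correct {L : ℕ} (h : Verifier X S) (n : ℕ) (τ : List S)
    (T : List (List S)) (hτ : Vouched (h x) T τ) (hL : τ.length + n ≤ L) :
    (search v x js n τ T).AllOutputs fun r =>
      ∀ σ, r.2 = some σ → CorrectTrace h x σ ∨ ∃ σ', Mistake L v (h x) r.1 true σ' := by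
  induction n generalizing τ T with
  | zero =>
    rintro _ ⟨⟩
    exact Or.inl fun l h1 h2 => (hτ l h1 h2).2
  | succ n ih =>
    refine (allOutputs_sampleSteps_length x τ js).bind fun cs _ => ?_
    split
    · simp [AllOutputs]
    · rename_i s hs
      have hmem : τ ++ [s] ∈ T ++ cs.map fun s => τ ++ [s] :=
        List.mem_append_right _ (List.mem_map_of_mem (List.mem_of_find?_eq_some hs))
      have hv := List.find?_some hs
      cases hh : h x (τ ++ [s]) with
      | true =>
        exact ih _ _ (hτ.snoc (List.subset_append_left _ _) hmem hh) (by simp; lia)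
      | false =>
        refine (allOutputs_search_subset v x js n _ _).mono fun r hr σ _ => Or.inr ⟨τ ++ [s], ?_⟩
        exact (hτ.mistake_snoc (List.subset_append_left _ _) hmem (by lia) hv hh).mono hr

theorem generated_snoc {P : Fin k → Prover X S} {x : X} {τ : List S} {s : S}
    (hτ : Generated P x τ) (hs : ∃ j, s ∈ (P j x τ).support) : Generated P x (τ ++ [s]) := by
  intro n hn
  rw [List.length_append, List.length_singleton] at hn
  rcases Nat.lt_or_ge n τ.length with hl | hl
  · obtain ⟨j, hj⟩ := hτ n hl
    refine ⟨j, ?_⟩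
    rw [List.getElem_append_left hl, List.take_append_of_le_length hl.le]
    exact hj
  · obtain rfl : n = τ.length := by lia
    obtain ⟨j, hj⟩ := hs
    exact ⟨j, by simpa using hj⟩

/-- As long as no mistake appears, the search follows correct traces generated by the provers, so
goodness supplies at each layer a prover that succeeds with probability at least `α`. Without
mistakes a layer fails only if no sample is correct, and a union bound over layers finishes. -/
theorem search_none_le {L N : ℕ} {P : Fin k → Prover X S} {h : Verifier X S} {α : ℝ}
    (hα1 : α ≤ 1) (hgood : GoodOn P h L α x) (hjs : ∀ j, js.count j = N) (n : ℕ)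
    (τ : List S) (T : List (List S)) (hτ : Vouched (h x) T τ) (hgen : Generated P x τ)
    (hL : τ.length + n ≤ L) :
    ((search v x js n τ T).law P).toOuterMeasure
        {r | r.2 = none ∧ ∀ b, ¬ ∃ σ, Mistake L v (h x) r.1 b σ} ≤
      n * ENNReal.ofReal ((1 - α) ^ N) := by
  induction n generalizing τ T with
  | zero => simp [search, law, PMF.toOuterMeasure_pure_apply]
  | succ n ih =>
    set c := ENNReal.ofReal ((1 - α) ^ N)
    obtain ⟨j, hj⟩ := hgood τ (by lia) hgen fun l h1 h2 => (hτ l h1 h2).2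
    set G := {s | h x (τ ++ [s]) = true}
    rw [search, law_bind, toOuterMeasure_bind]
    have key : ∀ cs ∈ ((sampleSteps x τ js).law P).support,
        (law P (match cs.find? fun s => v (τ ++ [s]) with
          | none => .output (T ++ cs.map fun s => τ ++ [s], none)
          | some s => search v x js n (τ ++ [s]) (T ++ cs.map fun s => τ ++ [s]))).toOuterMeasure
            {r | r.2 = none ∧ ∀ b, ¬ ∃ σ, Mistake L v (h x) r.1 b σ} ≤
          {cs : List S | ∀ s ∈ cs, s ∉ G}.indicator 1 cs + n * c := by
      intro cs hcs
      split
      · rename_i hnone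
        by_cases hmiss : cs ∈ {cs : List S | ∀ s ∈ cs, s ∉ G}
        · rw [Set.indicator_of_mem hmiss]
          exact (toOuterMeasure_le_one _ _).trans le_self_add
        · rw [toOuterMeasure_eq_zero]
          · exact zero_le
          · intro r hr hr'
            simp only [law, PMF.support_pure, Set.mem_singleton_iff] at hr
            subst hr
            simp only [Set.mem_ofPred_eq, not_forall, not_not] at hmiss
            obtain ⟨s, hs, hG⟩ := hmiss
            rw [List.find?_eq_none] at hnone
            -- A correct sample was drawn but nothing was accepted: this is a false rejection, which
            -- the event excludes.
            refine hr'.2 false ⟨τ ++ [s], hτ.mistake_snoc (List.subset_append_left _ _)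
              (List.mem_append_right _ (List.mem_map_of_mem hs)) (by lia) ?_ hG⟩
            simpa using hnone s hs
      · rename_i s hs
        have hscs := List.mem_of_find?_eq_some hs
        have hmem : τ ++ [s] ∈ T ++ cs.map fun s => τ ++ [s] :=
          List.mem_append_right _ (List.mem_map_of_mem hscs)
        have hv := List.find?_some hs
        cases hh : h x (τ ++ [s]) with
        | true =>
          exact (ih _ _ (hτ.snoc (List.subset_append_left _ _) hmem hh)
            (generated_snoc hgen (exists_mem_support_of_sampleSteps hcs hscs))
            (by simp; lia)).trans le_add_self
        | false =>
          rw [toOuterMeasure_eq_zero]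
          · exact zero_le
          · intro r hr hr'
            have hsub := (allOutputs_search_subset v x js n _ _).of_mem_support hr
            exact hr'.2 true ⟨_, (hτ.mistake_snoc (List.subset_append_left _ _) hmem (by lia)
              hv hh).mono hsub⟩
    refine (expect_mono_support key).trans ?_
    rw [expect_add, expect_const, ← toOuterMeasure_eq_expect, Nat.cast_succ, add_mul, one_mul,
      add_comm]
    gcongr
    exact (sampleSteps_miss_le hα1 hj js).trans_eq (by rw [hjs])

end ProverProgram

/-! ### Learners: composition, laws and costs. -/

namespace Learner

variable {X : Type u} {S : Type v} {k : ℕ} {R R' : Type*}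

/-- Sequential composition. -/
def bind : Learner X S k R → (R → Learner X S k R') → Learner X S k R'
  | .output r, f => f r
  | .drawProblem next, f => .drawProblem fun x => (next x).bind f
  | .callProver j x τ next, f => .callProver j x τ fun s => (next s).bind f
  | .queryOracle x τ next, f => .queryOracle x τ fun b => (next b).bind f

theorem law_bind (D : PMF X) (P : Fin k → Prover X S) (h : Verifier X S) (A : Learner X S k R)
    (f : R → Learner X S k R') :
    (A.bind f).law D P h = (A.law D P h).bind fun r => (f r).law D P h := by
  induction A with
  | output r => simp [bind, law]
  | drawProblem next ih => simp [bind, law, ih]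
  | callProver j x τ next ih => simp [bind, law, ih]
  | queryOracle x τ next ih => simp [bind, law, ih]

theorem DrawsAtMost.mono {A : Learner X S k R} {m n : ℕ} (hA : A.DrawsAtMost m) (hmn : m ≤ n) :
    A.DrawsAtMost n := by
  induction A generalizing m n with
  | output r => trivial
  | drawProblem next ih =>
    cases m with
    | zero => exact hA.elim
    | succ m =>
      obtain ⟨n, rfl⟩ : ∃ n', n = n' + 1 := ⟨n - 1, by lia⟩
      exact fun x => ih x (hA x) (by lia)
  | callProver j x τ next ih => exact fun s => ih s (hA s) hmn
  | queryOracle x τ next ih => exact fun b => ih b (hA b) hmn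

theorem QueriesAtMost.mono {A : Learner X S k R} {m n : ℕ} (hA : A.QueriesAtMost m)
    (hmn : m ≤ n) : A.QueriesAtMost n := by
  induction A generalizing m n with
  | output r => trivial
  | drawProblem next ih => exact fun x => ih x (hA x) hmn
  | callProver j x τ next ih => exact fun s => ih s (hA s) hmn
  | queryOracle x τ next ih =>
    cases m with
    | zero => exact hA.elim
    | succ m =>
      obtain ⟨n, rfl⟩ : ∃ n', n = n' + 1 := ⟨n - 1, by lia⟩
      exact fun b => ih b (hA b) (by lia)

theorem DrawsAtMost.bind {A : Learner X S k R} {f : R → Learner X S k R'} {m n : ℕ}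
    (hA : A.DrawsAtMost m) (hf : ∀ r, (f r).DrawsAtMost n) : (A.bind f).DrawsAtMost (m + n) := by
  induction A generalizing m with
  | output r => exact (hf r).mono (Nat.le_add_left _ _)
  | drawProblem next ih =>
    cases m with
    | zero => exact hA.elim
    | succ m =>
      rw [Nat.succ_add]
      exact fun x => ih x (hA x)
  | callProver j x τ next ih => exact fun s => ih s (hA s)
  | queryOracle x τ next ih => exact fun b => ih b (hA b)

theorem QueriesAtMost.bind {A : Learner X S k R} {f : R → Learner X S k R'} {m n : ℕ}
    (hA : A.QueriesAtMost m) (hf : ∀ r, (f r).QueriesAtMost n) :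
    (A.bind f).QueriesAtMost (m + n) := by
  induction A generalizing m with
  | output r => exact (hf r).mono (Nat.le_add_left _ _)
  | drawProblem next ih => exact fun x => ih x (hA x)
  | callProver j x τ next ih => exact fun s => ih s (hA s)
  | queryOracle x τ next ih =>
    cases m with
    | zero => exact hA.elim
    | succ m =>
      rw [Nat.succ_add]
      exact fun b => ih b (hA b)

/-- Run a prover program, then a learner. -/
def runProgram : ProverProgram X S k R → (R → Learner X S k R') → Learner X S k R'
  | .output r, f => f r
  | .callProver j x τ next, f => .callProver j x τ fun s => runProgram (next s) f

theorem law_runProgram (D : PMF X) (P : Fin k → Prover X S) (h : Verifier X S)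
    (A : ProverProgram X S k R) (f : R → Learner X S k R') :
    (runProgram A f).law D P h = (A.law P).bind fun r => (f r).law D P h := by
  induction A with
  | output r => simp [runProgram, ProverProgram.law]
  | callProver j x τ next ih => simp [runProgram, law, ProverProgram.law, ih]

theorem drawsAtMost_runProgram {A : ProverProgram X S k R} {f : R → Learner X S k R'} {n : ℕ}
    (hf : ∀ r, (f r).DrawsAtMost n) : (runProgram A f).DrawsAtMost n := by
  induction A with
  | output r => exact hf r
  | callProver j x τ next ih => exact ih

theorem queriesAtMost_runProgram {A : ProverProgram X S k R} {f : R → Learner X S k R'} {n : ℕ}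
    (hA : A.AllOutputs fun r => (f r).QueriesAtMost n) : (runProgram A f).QueriesAtMost n := by
  induction A with
  | output r => exact hA
  | callProver j x τ next ih => exact fun s => ih s (hA s)

/-- Query the oracle on each of the given traces, and return those labelled yes. -/
def queryAll (x : X) : List (List S) → Learner X S k (List (List S))
  | [] => .output []
  | τ :: T => .queryOracle x τ fun b =>
      (queryAll x T).bind fun F => .output (bif b then τ :: F else F)

theorem law_queryAll (D : PMF X) (P : Fin k → Prover X S) (h : Verifier X S) (x : X)
    (T : List (List S)) : (queryAll x T).law D P h = PMF.pure (T.filter (h x)) := by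
  induction T with
  | nil => rfl
  | cons τ T ih =>
    rw [queryAll, law, law_bind, ih, PMF.pure_bind, law]
    cases hh : h x τ <;> simp [hh]

theorem drawsAtMost_queryAll (x : X) (T : List (List S)) :
    (queryAll (k := k) x T).DrawsAtMost 0 := by
  induction T with
  | nil => trivial
  | cons τ T ih => exact fun b => ih.bind (n := 0) fun F => trivial

theorem queriesAtMost_queryAll (x : X) (T : List (List S)) :
    (queryAll (k := k) x T).QueriesAtMost T.length := by
  induction T with
  | nil => trivial
  | cons τ T ih => exact fun b => ih.bind (n := 0) fun F => trivial

/-- Draw `n` problems. -/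
def drawProblems : ℕ → Learner X S k (List X)
  | 0 => .output []
  | n + 1 => .drawProblem fun x => (drawProblems n).bind fun xs => .output (x :: xs)

theorem drawsAtMost_drawProblems (n : ℕ) :
    (drawProblems (X := X) (S := S) (k := k) n).DrawsAtMost n := by
  induction n with
  | zero => trivial
  | succ n ih => exact fun x => ih.bind (n := 0) fun xs => trivial

theorem bind_assoc {R'' : Type*} (A : Learner X S k R) (f : R → Learner X S k R')
    (g : R' → Learner X S k R'') : (A.bind f).bind g = A.bind fun r => (f r).bind g := by
  induction A with
  | output r => rfl
  | drawProblem next ih => simp only [bind, ih]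
  | callProver j x τ next ih => simp only [bind, ih]
  | queryOracle x τ next ih => simp only [bind, ih]

/-- Unlike the general bound for `bind`, this one remembers how many problems were drawn, on which
the cost of validation depends. -/
theorem queriesAtMost_drawProblems_bind {n q : ℕ} {f : List X → Learner X S k R}
    (hf : ∀ xs, xs.length = n → (f xs).QueriesAtMost q) :
    ((drawProblems n).bind f).QueriesAtMost q := by
  induction n generalizing f with
  | zero => exact hf [] rfl
  | succ n ih =>
    intro x
    change (((drawProblems n).bind fun xs => output (x :: xs)).bind f).QueriesAtMost q
    rw [bind_assoc]
    exact ih fun xs hxs => hf _ (by simp [hxs])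

end Learner

/-! ### Conservative histories and the potential. -/

/-- A list of labelled examples. -/
abbrev History (X : Type u) (S : Type v) := List ((X × List S) × Bool)

section Histories

variable {X : Type u} {S : Type v}

theorem soundnessMistakes_append (V : OnlineVerifier X S) (h : Verifier X S) (hist : History X S)
    (zs : List (X × List S)) (z : X × List S) :
    soundnessMistakes V h hist (zs ++ [z]) = soundnessMistakes V h hist zs +
      if V (hist ++ zs.map fun z => (z, h z.1 z.2)) z = true ∧ h z.1 z.2 = false
        then 1 else 0 := by
  induction zs generalizing hist with
  | nil => simp [soundnessMistakes]
  | cons y ys ih =>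
    simp only [List.cons_append, soundnessMistakes, ih, List.map_cons, List.append_assoc,
      List.nil_append, add_assoc]

theorem completenessMistakes_append (V : OnlineVerifier X S) (h : Verifier X S)
    (hist : History X S) (zs : List (X × List S)) (z : X × List S) :
    completenessMistakes V h hist (zs ++ [z]) = completenessMistakes V h hist zs +
      if V (hist ++ zs.map fun z => (z, h z.1 z.2)) z = false ∧ h z.1 z.2 = true
        then 1 else 0 := by
  induction zs generalizing hist with
  | nil => simp [completenessMistakes]
  | cons y ys ih =>
    simp only [List.cons_append, completenessMistakes, ih, List.map_cons, List.append_assoc,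
      List.nil_append, add_assoc]

/-- The histories that arise when `V` is shown only legal examples on which it errs. -/
inductive ErrorHistory (V : OnlineVerifier X S) (h : Verifier X S) (L : ℕ) : History X S → Prop
  | nil : ErrorHistory V h L []
  | snoc {hist : History X S} {z : X × List S} (hhist : ErrorHistory V h L hist)
      (hz : LegalExample h L z) (herr : V hist z = !h z.1 z.2) :
      ErrorHistory V h L (hist ++ [(z, h z.1 z.2)])

/-- The number of examples of a history on which the prediction `b` was wrong. -/
def errorCount (b : Bool) (hist : History X S) : ℕ := hist.countP fun y => y.2 == !b

theorem errorCount_snoc (b : Bool) (hist : History X S) (y : (X × List S) × Bool) :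
    errorCount b (hist ++ [y]) = errorCount b hist + if y.2 = !b then 1 else 0 := by
  simp [errorCount, List.countP_append, List.countP_singleton]

theorem errorCount_add (hist : History X S) :
    errorCount true hist + errorCount false hist = hist.length := by
  induction hist using List.reverseRecOn with
  | nil => rfl
  | append_singleton hist y ih =>
    rw [errorCount_snoc, errorCount_snoc, List.length_append, ← ih]
    cases y.2 <;> simp <;> lia

/-- Replaying the recorded examples from scratch shows `V` exactly the histories on which it erred,
so every one of them is again a mistake. Its kind can be read off the label. -/
theorem ErrorHistory.exists_examples {V : OnlineVerifier X S} {h : Verifier X S} {L : ℕ}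
    {hist : History X S} (hhist : ErrorHistory V h L hist) :
    ∃ zs : List (X × List S), hist = zs.map (fun z => (z, h z.1 z.2)) ∧
      (∀ z ∈ zs, LegalExample h L z) ∧
      soundnessMistakes V h [] zs = errorCount true hist ∧
      completenessMistakes V h [] zs = errorCount false hist := by
  induction hhist with
  | nil => exact ⟨[], rfl, by simp, rfl, rfl⟩
  | @snoc hist z hhist hz herr ih =>
    obtain ⟨zs, rfl, hlegal, hs, hc⟩ := ih
    refine ⟨zs ++ [z], by simp, ?_, ?_, ?_⟩
    · intro y hy
      rcases List.mem_append.1 hy with hy | hy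
      · exact hlegal y hy
      · rw [List.mem_singleton.1 hy]
        exact hz
    · rw [soundnessMistakes_append, errorCount_snoc, hs, List.nil_append, herr]
      cases h z.1 z.2 <;> simp
    · rw [completenessMistakes_append, errorCount_snoc, hc, List.nil_append, herr]
      cases h z.1 z.2 <;> simp

/-- The mistake bound for wrong predictions `b`. -/
def mistakeBound (Ms Mc : ℕ) (b : Bool) : ℕ := bif b then Ms else Mc

theorem ErrorHistory.errorCount_le {V : OnlineVerifier X S} {H : Set (Verifier X S)}
    {L Ms Mc : ℕ} (hV : HasMistakeBounds V H L Ms Mc) {h : Verifier X S} (hH : h ∈ H)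
    {hist : History X S} (hhist : ErrorHistory V h L hist) (b : Bool) :
    errorCount b hist ≤ mistakeBound Ms Mc b := by
  obtain ⟨zs, -, hlegal, hs, hc⟩ := hhist.exists_examples
  have := hV h hH zs hlegal
  cases b
  · exact hc ▸ this.2
  · exact hs ▸ this.1

theorem ErrorHistory.length_le {V : OnlineVerifier X S} {H : Set (Verifier X S)}
    {L Ms Mc : ℕ} (hV : HasMistakeBounds V H L Ms Mc) {h : Verifier X S} (hH : h ∈ H)
    {hist : History X S} (hhist : ErrorHistory V h L hist) : hist.length ≤ Ms + Mc := by
  rw [← errorCount_add]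
  exact add_le_add (hhist.errorCount_le hV hH true) (hhist.errorCount_le hV hH false)

/-- The verifier given by `V` after the history `hist`, on the traces for the problem `x`. -/
def verdict (V : OnlineVerifier X S) (hist : History X S) (x : X) (σ : List S) : Bool :=
  V hist (x, σ)

/-- The prefix condition in `Mistake` is what makes the example legal. -/
theorem ErrorHistory.snoc_mistake {V : OnlineVerifier X S} {h : Verifier X S} {L : ℕ}
    {hist : History X S} (hhist : ErrorHistory V h L hist) {x : X} {T : List (List S)} {b : Bool}
    {σ : List S} (hσ : Mistake L (verdict V hist x) (h x) T b σ) :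
    ErrorHistory V h L (hist ++ [((x, σ), !b)]) := by
  obtain ⟨-, h1, h2, h3, h4, h5⟩ := hσ
  rw [← h4]
  refine hhist.snoc (z := (x, σ)) ⟨h1, h2, fun l hl hl' => ?_⟩ ?_
  · have hlen : σ.dropLast.length = σ.length - 1 := List.length_dropLast
    have hpos : 0 < σ.length := List.length_pos_iff.2 h1
    have : σ.dropLast.take l = σ.take l := by
      rw [List.dropLast_eq_take, List.take_take]
      congr 1
      simp only [hlen] at hl'
      lia
    simp only [this]
    exact (h5 l hl (by simp only [hlen] at hl'; lia)).2
  · simp [h4, ← h3, verdict]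

open Classical in
/-- Append to the history a mistake on the transcript `T` for `x`, if there is one; mistakes with
the wrong prediction `p` are preferred. -/
noncomputable def update (V : OnlineVerifier X S) (L : ℕ) (p : Bool) (hist : History X S) (x : X)
    (T : List (List S)) (h : List S → Bool) : History X S :=
  if hp : ∃ σ, Mistake L (verdict V hist x) h T p σ then hist ++ [((x, hp.choose), !p)]
  else if hn : ∃ σ, Mistake L (verdict V hist x) h T (!p) σ then hist ++ [((x, hn.choose), p)]
  else hist

theorem prefix_update (V : OnlineVerifier X S) (L : ℕ) (p : Bool) (hist : History X S) (x : X)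
    (T : List (List S)) (h : List S → Bool) : hist <+: update V L p hist x T h := by
  unfold update
  split_ifs
  · exact List.prefix_append _ _
  · exact List.prefix_append _ _
  · exact List.prefix_rfl

theorem ErrorHistory.update {V : OnlineVerifier X S} {h : Verifier X S} {L : ℕ}
    {hist : History X S} (hhist : ErrorHistory V h L hist) (p : Bool) (x : X)
    (T : List (List S)) : ErrorHistory V h L (update V L p hist x T (h x)) := by
  unfold CoTVerification.update
  split_ifs with hp hn
  · exact hhist.snoc_mistake hp.choose_spec
  · simpa using hhist.snoc_mistake hn.choose_spec
  · exact hhist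

/-- A bound for the probability of a long training phase: the exponential of the weighted number
of mistakes still allowed. -/
noncomputable def potential (w : Bool → ℝ) (M : Bool → ℕ) (hist : History X S) : ℝ :=
  Real.exp (w true * (M true - errorCount true hist) + w false * (M false - errorCount false hist))

theorem potential_snoc (w : Bool → ℝ) (M : Bool → ℕ) (hist : History X S) (z : X × List S)
    (b : Bool) : potential w M (hist ++ [(z, !b)]) = potential w M hist * Real.exp (-w b) := by
  rw [potential, potential, ← Real.exp_add]
  congr 1
  cases b <;> simp [errorCount_snoc] <;> ring

-- A problem may show mistakes of both kinds although only one is recorded. Preferring the kind `p`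
-- of larger weight guarantees that the decrease is at least the one owed to any kind `b` that
-- occurred.
open Classical in
theorem potential_update_le {w : Bool → ℝ} (hw : ∀ b, 0 ≤ w b) {p : Bool} (hp : w (!p) ≤ w p)
    (M : Bool → ℕ) (V : OnlineVerifier X S) (L : ℕ) (hist : History X S) (x : X)
    (T : List (List S)) (h : List S → Bool) (b : Bool) :
    potential w M (update V L p hist x T h) ≤ potential w M hist *
      if ∃ σ, Mistake L (verdict V hist x) h T b σ then Real.exp (-w b) else 1 := by
  have hpos : 0 ≤ potential w M hist := (Real.exp_pos _).le
  have hwp : w b ≤ w p := by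
    rcases Bool.eq_or_eq_not b p with rfl | rfl
    · exact le_rfl
    · exact hp
  have h1 : ∀ b', Real.exp (-w b') ≤ 1 := fun b' => Real.exp_le_one_iff.2 (by linarith [hw b'])
  unfold update
  split_ifs with h2 h3 h4 h5 h6
  · rw [potential_snoc]
    gcongr
  · rw [potential_snoc]
    gcongr
    exact h1 p
  · have := potential_snoc w M hist (x, h4.choose) (!p)
    rw [Bool.not_not] at this
    rw [this]
    rcases Bool.eq_or_eq_not b p with rfl | rfl
    · exact absurd h5 h2
    · exact le_rfl
  · have := potential_snoc w M hist (x, h4.choose) (!p)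
    rw [Bool.not_not] at this
    rw [this]
    gcongr
    exact h1 _
  · rcases Bool.eq_or_eq_not b p with rfl | rfl
    · exact absurd h6 h2
    · exact absurd h6 h4
  · simp

end Histories

/-! ### The training phase and its failure probability. -/

section Training

variable {X : Type u} {S : Type v} {k : ℕ}

/-- The transcript and the result of the search on a random problem. -/
noncomputable def searchLaw (V : OnlineVerifier X S) (L : ℕ) (js : List (Fin k)) (D : PMF X)
    (P : Fin k → Prover X S) (hist : History X S) :
    PMF (X × (List (List S) × Option (List S))) :=
  D.bind fun x => ((ProverProgram.search (verdict V hist x) x js L [] []).law P).map fun r => (x, r)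

/-- The event that the search makes a mistake with the wrong prediction `b`. -/
def mistakeEvent (V : OnlineVerifier X S) (L : ℕ) (h : Verifier X S) (hist : History X S)
    (b : Bool) : Set (X × (List (List S) × Option (List S))) :=
  {ω | ∃ σ, Mistake L (verdict V hist ω.1) (h ω.1) ω.2.1 b σ}

/-- Appending such a mistake would give an error history exceeding a zero budget. -/
theorem prob_mistakeEvent_eq_zero {V : OnlineVerifier X S} {H : Set (Verifier X S)}
    {L Ms Mc : ℕ} (hV : HasMistakeBounds V H L Ms Mc) {h : Verifier X S} (hH : h ∈ H)
    {hist : History X S} (hhist : ErrorHistory V h L hist) {b : Bool}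
    (hb : mistakeBound Ms Mc b = 0)
    (p : PMF (X × (List (List S) × Option (List S)))) :
    prob p (mistakeEvent V L h hist b) = 0 := by
  rw [prob, toOuterMeasure_eq_zero, ENNReal.toReal_zero]
  rintro ω - ⟨σ, hσ⟩
  have := (hhist.snoc_mistake hσ).errorCount_le hV hH b
  rw [errorCount_snoc, hb] at this
  simp at this

namespace Learner

open Classical in
/-- Run the search on `x`, query the oracle on its transcript, and pass the
transcript and the labelling of its members to `f`. -/
noncomputable def examine {R : Type*} (V : OnlineVerifier X S) (L : ℕ) (js : List (Fin k))
    (hist : History X S) (x : X) (f : List (List S) → (List S → Bool) → Learner X S k R) :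
    Learner X S k R :=
  runProgram (ProverProgram.search (verdict V hist x) x js L [] []) fun r =>
    (queryAll x r.1).bind fun F => f r.1 fun σ => decide (σ ∈ F)

theorem drawsAtMost_examine {R : Type*} {V : OnlineVerifier X S} {L : ℕ} {js : List (Fin k)}
    {hist : History X S} {x : X} {f : List (List S) → (List S → Bool) → Learner X S k R} {n : ℕ}
    (hf : ∀ T F, (f T F).DrawsAtMost n) : (examine V L js hist x f).DrawsAtMost n := by
  refine drawsAtMost_runProgram fun r => ?_
  rw [← Nat.zero_add n]
  exact (drawsAtMost_queryAll x r.1).bind fun F => hf _ _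

theorem queriesAtMost_examine {R : Type*} {V : OnlineVerifier X S} {L : ℕ} {js : List (Fin k)}
    {hist : History X S} {x : X} {f : List (List S) → (List S → Bool) → Learner X S k R} {n : ℕ}
    (hf : ∀ T F, (f T F).QueriesAtMost n) :
    (examine V L js hist x f).QueriesAtMost (L * js.length + n) := by
  refine queriesAtMost_runProgram <|
    (ProverProgram.allOutputs_search_length _ x js L [] []).mono fun r hr => ?_
  rw [List.length_nil, Nat.zero_add] at hr
  exact ((queriesAtMost_queryAll x r.1).mono hr).bind fun F => hf _ _

/-- The labelling handed to `f` is false outside the transcript and need not agree with `h` there;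
`hf` says that this is immaterial. -/
theorem law_examine {R : Type*} (D : PMF X) (P : Fin k → Prover X S) (h : Verifier X S)
    {V : OnlineVerifier X S} {L : ℕ} {js : List (Fin k)}
    {hist : History X S} {x : X} {f : List (List S) → (List S → Bool) → Learner X S k R}
    (hf : ∀ T F F', (∀ σ ∈ T, F σ = F' σ) → f T F = f T F') :
    (examine V L js hist x f).law D P h =
      ((ProverProgram.search (verdict V hist x) x js L [] []).law P).bind fun r =>
        (f r.1 (h x)).law D P h := by
  rw [examine, law_runProgram]
  congr 1
  funext r
  rw [law_bind, law_queryAll, PMF.pure_bind]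
  congr 1
  refine hf _ _ _ fun σ hσ => ?_
  cases hh : h x σ <;> simp [hσ, hh]

/-- The training phase: on each of `n` problems, run the search with the current verifier and
update the history. -/
noncomputable def train (V : OnlineVerifier X S) (L : ℕ) (js : List (Fin k)) (p : Bool) :
    ℕ → History X S → Learner X S k (History X S)
  | 0, hist => .output hist
  | n + 1, hist => .drawProblem fun x => examine V L js hist x fun T F =>
      train V L js p n (update V L p hist x T F)

variable {V : OnlineVerifier X S} {L : ℕ} {js : List (Fin k)}

theorem drawsAtMost_train (p : Bool) (n : ℕ) (hist : History X S) :
    (train V L js p n hist).DrawsAtMost n := by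
  induction n generalizing hist with
  | zero => trivial
  | succ n ih => exact fun x => drawsAtMost_examine fun T F => ih _

theorem queriesAtMost_train (p : Bool) (n : ℕ) (hist : History X S) :
    (train V L js p n hist).QueriesAtMost (n * (L * js.length)) := by
  induction n generalizing hist with
  | zero => trivial
  | succ n ih =>
    rw [Nat.succ_mul, Nat.add_comm (n * _)]
    exact fun x => queriesAtMost_examine fun T F => ih _

theorem law_train_succ (D : PMF X) (P : Fin k → Prover X S) (h : Verifier X S) (p : Bool) (n : ℕ)
    (hist : History X S) :
    (train V L js p (n + 1) hist).law D P h = (searchLaw V L js D P hist).bind fun ω =>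
      (train V L js p n (update V L p hist ω.1 ω.2.1 (h ω.1))).law D P h := by
  rw [train, law, searchLaw, PMF.bind_bind]
  congr 1
  funext x
  rw [law_examine, PMF.bind_map]
  · rfl
  · intro T F F' hF
    unfold update
    rw [Mistake.congr hF]

theorem prefix_of_mem_support_train {D : PMF X} {P : Fin k → Prover X S} {h : Verifier X S}
    {p : Bool} {n : ℕ} {hist hist' : History X S}
    (hh : hist' ∈ ((train V L js p n hist).law D P h).support) : hist <+: hist' := by
  induction n generalizing hist with
  | zero =>
    simp only [train, law, PMF.support_pure, Set.mem_singleton_iff] at hh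
    rw [hh]
  | succ n ih =>
    rw [law_train_succ, PMF.mem_support_bind_iff] at hh
    obtain ⟨ω, -, hω⟩ := hh
    exact (prefix_update _ _ _ _ _ _ _).trans (ih hω)

theorem errorHistory_of_mem_support_train {D : PMF X} {P : Fin k → Prover X S}
    {h : Verifier X S} {p : Bool} {n : ℕ} {hist hist' : History X S}
    (hhist : ErrorHistory V h L hist)
    (hh : hist' ∈ ((train V L js p n hist).law D P h).support) : ErrorHistory V h L hist' := by
  induction n generalizing hist with
  | zero =>
    simp only [train, law, PMF.support_pure, Set.mem_singleton_iff] at hh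
    rwa [hh]
  | succ n ih =>
    rw [law_train_succ, PMF.mem_support_bind_iff] at hh
    obtain ⟨ω, -, hω⟩ := hh
    exact ih (hhist.update _ _ _) hω

end Learner

theorem ErrorHistory.take {V : OnlineVerifier X S} {h : Verifier X S} {L : ℕ}
    {hist : History X S} (hhist : ErrorHistory V h L hist) (i : ℕ) :
    ErrorHistory V h L (hist.take i) := by
  induction hhist with
  | nil => simpa using ErrorHistory.nil
  | @snoc hist z hhist hz herr ih =>
    rcases Nat.lt_or_ge hist.length i with hi | hi
    · rw [List.take_of_length_le (by simpa using hi)]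
      exact hhist.snoc hz herr
    · rwa [List.take_append_of_le_length hi]

namespace Learner

variable {V : OnlineVerifier X S} {L : ℕ} {js : List (Fin k)}

/-- The potential times `ρ ^ n` bounds the failure probability by induction on the problems left: if
the current verifier is bad for some `b`, one more problem multiplies the expected potential by at
most `ρ`; if it is good, failure is impossible. -/
theorem train_failure_le {H : Set (Verifier X S)} {Ms Mc : ℕ}
    (hV : HasMistakeBounds V H L Ms Mc) {h : Verifier X S} (hH : h ∈ H) {D : PMF X}
    {P : Fin k → Prover X S} {w θ : Bool → ℝ} (hw : ∀ b, 0 ≤ w b) {p : Bool} (hp : w (!p) ≤ w p)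
    {ρ : ℝ} (hρ0 : 0 ≤ ρ) (hρ : ∀ b, 1 + (Real.exp (-w b) - 1) * θ b ≤ ρ) (n : ℕ)
    {hist : History X S} (hhist : ErrorHistory V h L hist) :
    ((train V L js p n hist).law D P h).toOuterMeasure
        {hist' | ∀ i ≤ Ms + Mc, ∃ b,
          θ b < prob (searchLaw V L js D P (hist'.take i)) (mistakeEvent V L h (hist'.take i) b)} ≤
      ENNReal.ofReal (potential w (mistakeBound Ms Mc) hist * ρ ^ n) := by
  classical
  induction n generalizing hist with
  | zero =>
    refine (toOuterMeasure_le_one _ _).trans ?_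
    -- With no problem left the bound must be trivial: the errors stay within the budgets, so the
    -- exponent is nonnegative.
    rw [ENNReal.one_le_ofReal, pow_zero, mul_one, potential, Real.one_le_exp_iff]
    have hc : ∀ b, 0 ≤ w b * ((mistakeBound Ms Mc b : ℝ) - errorCount b hist) := fun b =>
      mul_nonneg (hw b) (sub_nonneg.2 (by exact_mod_cast hhist.errorCount_le hV hH b))
    exact add_nonneg (hc true) (hc false)
  | succ n ih =>
    by_cases hbad : ∃ b, θ b < prob (searchLaw V L js D P hist) (mistakeEvent V L h hist b)
    · obtain ⟨b, hb⟩ := hbad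
      set B := potential w (mistakeBound Ms Mc) hist
      have hB : 0 ≤ B := (Real.exp_pos _).le
      rw [law_train_succ, toOuterMeasure_bind]
      calc _ ≤ expect (searchLaw V L js D P hist) fun ω => ENNReal.ofReal (B * ρ ^ n) *
            ENNReal.ofReal (if ω ∈ mistakeEvent V L h hist b then Real.exp (-w b) else 1) := by
            refine expect_mono fun ω => (ih (hhist.update p _ _)).trans ?_
            rw [← ENNReal.ofReal_mul (by positivity), mul_right_comm]
            exact ENNReal.ofReal_le_ofReal (mul_le_mul_of_nonneg_right
              (potential_update_le hw hp _ V L hist ω.1 ω.2.1 (h ω.1) b) (by positivity))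
        _ ≤ ENNReal.ofReal (B * ρ ^ n) * ENNReal.ofReal ρ := by
            rw [expect_mul_left, expect_ite _ _ (Real.exp_pos _).le]
            gcongr
            refine le_trans ?_ (hρ b)
            have : Real.exp (-w b) ≤ 1 := Real.exp_le_one_iff.2 (by linarith [hw b])
            nlinarith
        _ = ENNReal.ofReal (B * ρ ^ (n + 1)) := by
            rw [← ENNReal.ofReal_mul (by positivity), pow_succ, mul_assoc]
    -- The current history is good and remains a prefix of the final one, so the index `hist.length`
    -- refutes failure.
    · rw [toOuterMeasure_eq_zero]
      · exact zero_le
      · intro hist' hsupp hfail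
        have := hfail hist.length (hhist.length_le hV hH)
        rw [List.prefix_iff_eq_take.1 (prefix_of_mem_support_train hsupp)] at hbad
        exact hbad this

end Learner

end Training

end CoTVerification

/-! ### Validation of the candidate verifiers. -/

namespace CoTVerification

variable {X : Type u} {S : Type v} {k : ℕ}

namespace Learner

open Classical in
/-- Run the search with a fixed history on the given problems, and count the problems on which it
makes mistakes of either kind. -/
noncomputable def countMistakes (V : OnlineVerifier X S) (L : ℕ) (js : List (Fin k))
    (hist : History X S) : List X → Learner X S k (Bool → ℕ)
  | [] => .output 0
  | x :: xs => examine V L js hist x fun T F => (countMistakes V L js hist xs).bind fun c =>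
      .output fun b => c b + if ∃ σ, Mistake L (verdict V hist x) F T b σ then 1 else 0

open Classical in
/-- The first history of a list that makes few mistakes on the problems `xs`. -/
noncomputable def select (V : OnlineVerifier X S) (L : ℕ) (js : List (Fin k)) (t : Bool → ℝ)
    (xs : List X) : List (History X S) → Learner X S k (History X S)
  | [] => .output []
  | hist :: hs => (countMistakes V L js hist xs).bind fun c =>
      if ∀ b, (c b : ℝ) ≤ t b then .output hist else select V L js t xs hs

/-- Train, then validate all the verifiers that occurred in training on the same `n₂` problems. -/
noncomputable def learnHistory (V : OnlineVerifier X S) (L : ℕ) (js : List (Fin k)) (p : Bool)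
    (t : Bool → ℝ) (M n₁ n₂ : ℕ) : Learner X S k (History X S) :=
  (train V L js p n₁ []).bind fun hist => (drawProblems n₂).bind fun xs =>
    select V L js t xs ((List.range (M + 1)).map fun i => hist.take i)

variable {V : OnlineVerifier X S} {L : ℕ} {js : List (Fin k)}

theorem drawsAtMost_countMistakes (hist : History X S) (xs : List X) :
    (countMistakes V L js hist xs).DrawsAtMost 0 := by
  induction xs with
  | nil => trivial
  | cons x xs ih => exact drawsAtMost_examine fun T F => ih.bind (n := 0) fun c => trivial

theorem queriesAtMost_countMistakes (hist : History X S) (xs : List X) :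
    (countMistakes V L js hist xs).QueriesAtMost (xs.length * (L * js.length)) := by
  induction xs with
  | nil => trivial
  | cons x xs ih =>
    rw [List.length_cons, Nat.succ_mul, Nat.add_comm (xs.length * _)]
    exact queriesAtMost_examine fun T F => ih.bind (n := 0) fun c => trivial

theorem drawsAtMost_select (t : Bool → ℝ) (xs : List X) (hs : List (History X S)) :
    (select V L js t xs hs).DrawsAtMost 0 := by
  induction hs with
  | nil => trivial
  | cons hist hs ih =>
    refine (drawsAtMost_countMistakes hist xs).bind (n := 0) fun c => ?_
    split_ifs
    · trivial
    · exact ih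

theorem queriesAtMost_select (t : Bool → ℝ) (xs : List X) (hs : List (History X S)) :
    (select V L js t xs hs).QueriesAtMost (hs.length * (xs.length * (L * js.length))) := by
  induction hs with
  | nil => trivial
  | cons hist hs ih =>
    rw [List.length_cons, Nat.succ_mul, Nat.add_comm (hs.length * _)]
    refine (queriesAtMost_countMistakes hist xs).bind fun c => ?_
    split_ifs
    · trivial
    · exact ih

theorem drawsAtMost_learnHistory (p : Bool) (t : Bool → ℝ) (M n₁ n₂ : ℕ) :
    (learnHistory V L js p t M n₁ n₂).DrawsAtMost (n₁ + n₂) :=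
  (drawsAtMost_train p n₁ []).bind fun _ => (drawsAtMost_drawProblems n₂).bind (n := 0) fun xs =>
    drawsAtMost_select t xs _

theorem queriesAtMost_learnHistory (p : Bool) (t : Bool → ℝ) (M n₁ n₂ : ℕ) :
    (learnHistory V L js p t M n₁ n₂).QueriesAtMost
      (n₁ * (L * js.length) + (M + 1) * (n₂ * (L * js.length))) := by
  refine (queriesAtMost_train p n₁ []).bind fun hist =>
    queriesAtMost_drawProblems_bind fun xs hxs => ?_
  simpa [hxs] using queriesAtMost_select t xs ((List.range (M + 1)).map fun i => hist.take i)

open Classical in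
theorem law_countMistakes_cons (D : PMF X) (P : Fin k → Prover X S) (h : Verifier X S)
    (hist : History X S) (x : X) (xs : List X) :
    (countMistakes V L js hist (x :: xs)).law D P h =
      ((ProverProgram.search (verdict V hist x) x js L [] []).law P).bind fun r =>
        ((countMistakes V L js hist xs).law D P h).map fun c b =>
          c b + if (x, r) ∈ mistakeEvent V L h hist b then 1 else 0 := by
  rw [countMistakes, law_examine]
  · congr 1
    funext r
    rw [law_bind, ← PMF.bind_pure_comp]
    rfl
  · intro T F F' hF
    rw [Mistake.congr hF]

/-- The moment generating function of the number of mistakes on `n` fresh problems. -/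
theorem expect_countMistakes (D : PMF X) (P : Fin k → Prover X S) (h : Verifier X S)
    (hist : History X S) (b : Bool) {y : ℝ} (hy : 0 ≤ y) (n : ℕ) :
    (expect ((drawProblems n).law D P h) fun xs =>
      expect ((countMistakes V L js hist xs).law D P h) fun c => ENNReal.ofReal (y ^ c b)) =
    ENNReal.ofReal
      (1 + (y - 1) * prob (searchLaw V L js D P hist) (mistakeEvent V L h hist b)) ^ n := by
  classical
  induction n with
  | zero => simp [drawProblems, law, countMistakes, expect_pure]
  | succ n ih =>
    rw [drawProblems, law, expect_bind, pow_succ', ← ih, ← expect_ite _ _ hy, searchLaw,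
      expect_bind, ← expect_mul_right]
    congr 1
    funext x
    rw [law_bind, expect_bind, expect_map, ← expect_mul_left]
    congr 1
    funext xs
    rw [law, expect_pure, law_countMistakes_cons, expect_bind, ← expect_mul_right]
    congr 1
    funext r
    rw [expect_map, ← expect_mul_left]
    congr 1
    funext c
    rw [← ENNReal.ofReal_mul (by split_ifs <;> positivity)]
    congr 1
    by_cases hm : (x, r) ∈ mistakeEvent V L h hist b
    · simp only [if_pos hm, pow_succ']
    · simp only [if_neg hm, add_zero, one_mul]

/-- The exponential Markov inequality. One statement serves both tails, with `y < 1` for the lower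
one and `y > 1` for the upper one. -/
theorem countMistakes_tail_le (D : PMF X) (P : Fin k → Prover X S) (h : Verifier X S)
    (hist : History X S) (b : Bool) {y : ℝ} (hy : 0 ≤ y) (a : ℝ) (n : ℕ) {s : Set (Bool → ℕ)}
    (hs : ∀ c ∈ s, 1 ≤ Real.exp a * y ^ c b) :
    (expect ((drawProblems n).law D P h) fun xs =>
      ((countMistakes V L js hist xs).law D P h).toOuterMeasure s) ≤
    ENNReal.ofReal (Real.exp (a + n * ((y - 1) *
      prob (searchLaw V L js D P hist) (mistakeEvent V L h hist b)))) := by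
  calc _ ≤ expect ((drawProblems n).law D P h) fun xs => ENNReal.ofReal (Real.exp a) *
        expect ((countMistakes V L js hist xs).law D P h) fun c => ENNReal.ofReal (y ^ c b) := by
        refine expect_mono fun xs => ?_
        rw [← expect_mul_left]
        refine toOuterMeasure_le_expect fun c hc => ?_
        rw [← ENNReal.ofReal_mul (Real.exp_pos a).le, ENNReal.one_le_ofReal]
        exact hs c hc
    _ ≤ _ := by
        rw [expect_mul_left, expect_countMistakes _ _ _ _ _ hy, Real.exp_add, Real.exp_nat_mul,
          ENNReal.ofReal_mul (Real.exp_pos a).le, ENNReal.ofReal_pow (Real.exp_pos _).le]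
        gcongr
        rw [add_comm]
        exact Real.add_one_le_exp _

/-- The counts that misjudge the mistake probabilities `q` at the scale `θ`. -/
def misleadingCounts (q θ : Bool → ℝ) (n : ℕ) (b : Bool) : Set (Bool → ℕ) :=
  {c | (θ b < q b ∧ (c b : ℝ) ≤ n * θ b / 2) ∨ (q b ≤ θ b / 4 ∧ n * θ b / 2 < c b)}

theorem misleadingCounts_le (D : PMF X) (P : Fin k → Prover X S) (h : Verifier X S)
    (hist : History X S) {θ : Bool → ℝ} (b : Bool) (hθ : 0 ≤ θ b) (n : ℕ) :
    (expect ((drawProblems n).law D P h) fun xs =>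
      ((countMistakes V L js hist xs).law D P h).toOuterMeasure (misleadingCounts
        (fun b => prob (searchLaw V L js D P hist) (mistakeEvent V L h hist b)) θ n b)) ≤
    ENNReal.ofReal (Real.exp (-(n * θ b / 16))) := by
  set q := fun b => prob (searchLaw V L js D P hist) (mistakeEvent V L h hist b)
  have hn : (0 : ℝ) ≤ n := n.cast_nonneg
  have hnθ : 0 ≤ n * θ b := by positivity
  by_cases hq : θ b < q b
  · refine (countMistakes_tail_le D P h hist b (Real.exp_pos (-1)).le (n * θ b / 2) n ?_).trans ?_
    · rintro c (⟨-, hc⟩ | ⟨hc, -⟩)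
      · rw [← Real.exp_nat_mul, ← Real.exp_add, Real.one_le_exp_iff]
        linarith
      · linarith
    · refine ENNReal.ofReal_le_ofReal (Real.exp_le_exp.2 ?_)
      -- This bounds the exponent by `nθ/2 - 5nθ/8 = -nθ/8`.
      have he : Real.exp (-1) ≤ 3 / 8 := by
        rw [Real.exp_neg, inv_le_comm₀ (Real.exp_pos 1) (by norm_num)]
        linarith [Real.exp_one_gt_d9]
      have h1 : (n : ℝ) * θ b ≤ n * q b := by gcongr
      change n * θ b / 2 + n * ((Real.exp (-1) - 1) * q b) ≤ _
      nlinarith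
  · by_cases hq' : q b ≤ θ b / 4
    · refine (countMistakes_tail_le D P h hist b (Real.exp_pos 1).le (-(n * θ b / 2)) n ?_).trans ?_
      · rintro c (⟨hc, -⟩ | ⟨-, hc⟩)
        · exact absurd hc hq
        · rw [← Real.exp_nat_mul, ← Real.exp_add, Real.one_le_exp_iff]
          linarith
      · refine ENNReal.ofReal_le_ofReal (Real.exp_le_exp.2 ?_)
        have h1 : (n : ℝ) * q b ≤ n * (θ b / 4) := by gcongr
        change -(n * θ b / 2) + n * ((Real.exp 1 - 1) * q b) ≤ _
        -- Since `(e - 1) / 4 - 1 / 2 < -1 / 16`, this tail is the one that dictates the constant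
        -- `16`.
        have he := Real.exp_one_lt_d9
        have hq0 : 0 ≤ n * q b := mul_nonneg hn (prob_nonneg _ _)
        nlinarith
    -- Between `θ / 4` and `θ` either verdict of the test is acceptable.
    · have : misleadingCounts q θ n b = ∅ :=
        Set.eq_empty_of_forall_notMem fun c hc => hc.elim (fun h => hq h.1) fun h => hq' h.1
      simp [this, expect]

/-- When no count is misleading, bad candidates are rejected and the good one is accepted if
reached. The runs are therefore charged by a union bound over candidates; for fixed `xs` no
independence between them is needed. -/
theorem select_failure_le (D : PMF X) (P : Fin k → Prover X S) (h : Verifier X S)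
    {θ : Bool → ℝ} {q : History X S → Bool → ℝ} {n : ℕ} (xs : List X) (hs : List (History X S))
    (hex : ∃ hist ∈ hs, ∀ b, q hist b ≤ θ b / 4) :
    ((select V L js (fun b => n * θ b / 2) xs hs).law D P h).toOuterMeasure
        {hist | ∃ b, θ b < q hist b} ≤
      (hs.map fun hist => ((countMistakes V L js hist xs).law D P h).toOuterMeasure
        (⋃ b, misleadingCounts (q hist) θ n b)).sum := by
  classical
  induction hs with
  | nil => simp at hex
  | cons hist hs ih =>
    rw [select, law_bind, toOuterMeasure_bind, List.map_cons, List.sum_cons,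
      toOuterMeasure_eq_expect _ (⋃ b, misleadingCounts (q hist) θ n b),
      ← expect_const ((countMistakes V L js hist xs).law D P h) (List.sum _), ← expect_add]
    refine expect_mono fun c => ?_
    by_cases hc : c ∈ ⋃ b, misleadingCounts (q hist) θ n b
    · rw [Set.indicator_of_mem hc]
      exact (toOuterMeasure_le_one _ _).trans le_self_add
    · simp only [misleadingCounts, Set.mem_iUnion, not_exists, Set.mem_ofPred_eq, not_or, not_and,
        not_le, not_lt] at hc
      refine le_trans ?_ le_add_self
      split_ifs with hpass
      · rw [law, toOuterMeasure_eq_zero]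
        · exact zero_le
        · rintro hist' hh ⟨b, hb⟩
          simp only [PMF.support_pure, Set.mem_singleton_iff] at hh
          subst hh
          exact absurd (hpass b) (not_le.2 ((hc b).1 hb))
      · refine ih ?_
        obtain ⟨g, hg, hgood⟩ := hex
        rcases List.mem_cons.1 hg with rfl | hg
        -- The good candidate cannot be the one just rejected, so it is still ahead in the list.
        · exact absurd (fun b => (hc b).2 (hgood b)) hpass
        · exact ⟨g, hg, hgood⟩

theorem mem_of_mem_support_select {D : PMF X} {P : Fin k → Prover X S} {h : Verifier X S}
    {t : Bool → ℝ} {xs : List X} {hs : List (History X S)} {hist : History X S}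
    (hh : hist ∈ ((select V L js t xs hs).law D P h).support) : hist ∈ hs ∨ hist = [] := by
  induction hs with
  | nil =>
    simp only [select, law, PMF.support_pure, Set.mem_singleton_iff] at hh
    exact Or.inr hh
  | cons hist' hs ih =>
    rw [select, law_bind, PMF.mem_support_bind_iff] at hh
    obtain ⟨c, -, hc⟩ := hh
    split_ifs at hc
    · simp only [law, PMF.support_pure, Set.mem_singleton_iff] at hc
      simp [hc]
    · rcases ih hc with h1 | h1
      · exact Or.inl (List.mem_cons_of_mem _ h1)
      · exact Or.inr h1

theorem errorHistory_of_mem_support_learnHistory {D : PMF X} {P : Fin k → Prover X S}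
    {h : Verifier X S} {p : Bool} {t : Bool → ℝ} {M n₁ n₂ : ℕ} {hist : History X S}
    (hh : hist ∈ ((learnHistory V L js p t M n₁ n₂).law D P h).support) :
    ErrorHistory V h L hist := by
  simp only [learnHistory, law_bind, PMF.mem_support_bind_iff] at hh
  obtain ⟨hist', hhist', xs, -, hsel⟩ := hh
  rcases mem_of_mem_support_select hsel with hmem | rfl
  · obtain ⟨i, -, rfl⟩ := List.mem_map.1 hmem
    exact (errorHistory_of_mem_support_train .nil hhist').take i
  · exact .nil

/-- Training aims at `θ / 4` so that validation at threshold `θ / 2` has a gap on both sides. The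
problems for validation are drawn after the candidates are fixed, hence the bounds for a fixed
history apply. -/
theorem learnHistory_failure_le {H : Set (Verifier X S)} {Ms Mc : ℕ}
    (hV : HasMistakeBounds V H L Ms Mc) {h : Verifier X S} (hH : h ∈ H) (D : PMF X)
    (P : Fin k → Prover X S) {w θ : Bool → ℝ} (hw : ∀ b, 0 ≤ w b) {p : Bool} (hp : w (!p) ≤ w p)
    (hθ : ∀ b, 0 ≤ θ b) {ρ : ℝ} (hρ0 : 0 ≤ ρ)
    (hρ : ∀ b, 1 + (Real.exp (-w b) - 1) * (θ b / 4) ≤ ρ) (n₁ n₂ : ℕ) {η : ℝ} (hη : 0 ≤ η)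
    (hn₂ : ∀ b, Real.exp (-(n₂ * θ b / 16)) ≤ η) :
    ((learnHistory V L js p (fun b => n₂ * θ b / 2) (Ms + Mc) n₁ n₂).law D P h).toOuterMeasure
        {hist | ∃ b, θ b < prob (searchLaw V L js D P hist) (mistakeEvent V L h hist b)} ≤
      ENNReal.ofReal (potential w (mistakeBound Ms Mc) ([] : History X S) * ρ ^ n₁ +
        (Ms + Mc + 1) * (2 * η)) := by
  set q : History X S → Bool → ℝ := fun hist b =>
    prob (searchLaw V L js D P hist) (mistakeEvent V L h hist b)
  set Bad : Set (History X S) := {hist | ∀ i ≤ Ms + Mc, ∃ b, θ b / 4 < q (hist.take i) b}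
  have hval : ∀ hist, hist ∉ Bad → (expect ((drawProblems n₂).law D P h) fun xs =>
      ((select V L js (fun b => n₂ * θ b / 2) xs
        ((List.range (Ms + Mc + 1)).map fun i => hist.take i)).law D P h).toOuterMeasure
          {hist | ∃ b, θ b < q hist b}) ≤ ENNReal.ofReal ((Ms + Mc + 1) * (2 * η)) := by
    intro hist hhist
    simp only [Bad, Set.mem_ofPred_eq, not_forall, not_exists, not_lt] at hhist
    obtain ⟨i, hi, hgood⟩ := hhist
    refine (expect_mono fun xs => select_failure_le D P h xs _
      ⟨hist.take i, List.mem_map.2 ⟨i, List.mem_range.2 (by lia), rfl⟩, hgood⟩).trans ?_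
    rw [expect_list_sum]
    refine (List.sum_le_card_nsmul _ (ENNReal.ofReal (2 * η)) fun z hz => ?_).trans_eq ?_
    · obtain ⟨g, -, rfl⟩ := List.mem_map.1 hz
      calc _ ≤ expect ((drawProblems n₂).law D P h) fun xs =>
            ((countMistakes V L js g xs).law D P h).toOuterMeasure
              (misleadingCounts (q g) θ n₂ true) +
            ((countMistakes V L js g xs).law D P h).toOuterMeasure
              (misleadingCounts (q g) θ n₂ false) := by
            refine expect_mono fun xs => ?_
            rw [Set.iUnion, iSup_bool_eq]
            exact MeasureTheory.measure_union_le _ _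
        _ ≤ ENNReal.ofReal η + ENNReal.ofReal η := by
            rw [expect_add]
            refine add_le_add ?_ ?_
            · exact (misleadingCounts_le D P h g true (hθ _) n₂).trans
                (ENNReal.ofReal_le_ofReal (hn₂ _))
            · exact (misleadingCounts_le D P h g false (hθ _) n₂).trans
                (ENNReal.ofReal_le_ofReal (hn₂ _))
        _ = ENNReal.ofReal (2 * η) := by rw [← ENNReal.ofReal_add hη hη, two_mul]
    · rw [List.length_map, List.length_map, List.length_range, nsmul_eq_mul,
        ENNReal.ofReal_mul (by positivity : (0 : ℝ) ≤ Ms + Mc + 1), ← ENNReal.ofReal_natCast]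
      push_cast
      rfl
  rw [learnHistory, law_bind, toOuterMeasure_bind,
    ENNReal.ofReal_add (p := potential _ _ _ * _) (mul_nonneg (Real.exp_pos _).le (pow_nonneg hρ0 _)) (by positivity)]
  calc _ ≤ expect ((train V L js p n₁ []).law D P h) fun hist =>
        Bad.indicator 1 hist + ENNReal.ofReal ((Ms + Mc + 1) * (2 * η)) := by
        refine expect_mono fun hist => ?_
        by_cases hb : hist ∈ Bad
        · rw [Set.indicator_of_mem hb]
          exact (toOuterMeasure_le_one _ _).trans le_self_add
        · rw [Set.indicator_of_notMem hb, zero_add, law_bind, toOuterMeasure_bind]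
          exact hval hist hb
    _ ≤ _ := by
        rw [expect_add, expect_const, ← toOuterMeasure_eq_expect]
        gcongr
        exact train_failure_le hV hH hw hp hρ0 hρ n₁ .nil

end Learner

/-! ### Guarantees of the search as an assisted prover. -/

/-- The search with the verifier given by a history, as an assisted prover. -/
def searchProver (V : OnlineVerifier X S) (L : ℕ) (js : List (Fin k)) (hist : History X S) :
    AssistedProver X S k := fun x =>
  (ProverProgram.search (verdict V hist x) x js L [] []).bind fun r => .output r.2

section SearchProver

variable {V : OnlineVerifier X S} {L : ℕ} {js : List (Fin k)}

theorem jointLaw_searchProver (P : Fin k → Prover X S) (D : PMF X) (hist : History X S) :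
    (searchProver V L js hist).jointLaw P D =
      (searchLaw V L js D P hist).map fun ω => (ω.1, ω.2.2) := by
  simp only [AssistedProver.jointLaw, searchProver, searchLaw, ProverProgram.law_bind,
    ProverProgram.law, ← PMF.bind_pure_comp, PMF.bind_bind,
    PMF.pure_bind, Function.comp_def]

theorem prob_map {β γ : Type*} (p : PMF β) (f : β → γ) (s : Set γ) :
    prob (p.map f) s = prob p (f ⁻¹' s) := by
  rw [prob, PMF.toOuterMeasure_map_apply, prob]

theorem prob_mono_support {β : Type*} {p : PMF β} {s t : Set β}
    (hst : ∀ a ∈ p.support, a ∈ s → a ∈ t) : prob p s ≤ prob p t :=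
  ENNReal.toReal_mono (toOuterMeasure_ne_top p t) (toOuterMeasure_mono_support hst)

theorem prob_union_le {β : Type*} (p : PMF β) (s t : Set β) :
    prob p (s ∪ t) ≤ prob p s + prob p t := by
  rw [prob, prob, prob, ← ENNReal.toReal_add (toOuterMeasure_ne_top p s)
    (toOuterMeasure_ne_top p t)]
  exact ENNReal.toReal_mono (ENNReal.add_ne_top.2 ⟨toOuterMeasure_ne_top p s,
    toOuterMeasure_ne_top p t⟩) (MeasureTheory.measure_union_le _ _)

theorem searchProver_output {P : Fin k → Prover X S} {hist : History X S} {x : X}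
    {o : Option (List S)} (ho : o ∈ ((searchProver V L js hist x).law P).support) :
    o = none ∨ ∃ τ : List S, τ.length = L ∧ o = some τ := by
  rw [searchProver, ProverProgram.law_bind, PMF.mem_support_bind_iff] at ho
  obtain ⟨r, hr, hro⟩ := ho
  simp only [ProverProgram.law, PMF.support_pure, Set.mem_singleton_iff] at hro
  subst hro
  simpa using (ProverProgram.allOutputs_search_output _ x js L [] []).of_mem_support hr

theorem mem_support_searchLaw {D : PMF X} {P : Fin k → Prover X S} {hist : History X S}
    {ω : X × (List (List S) × Option (List S))}
    (hω : ω ∈ (searchLaw V L js D P hist).support) :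
    ω.2 ∈ ((ProverProgram.search (verdict V hist ω.1) ω.1 js L [] []).law P).support := by
  rw [searchLaw, PMF.mem_support_bind_iff] at hω
  obtain ⟨x, -, hx⟩ := hω
  rw [PMF.support_map] at hx
  obtain ⟨r, hr, rfl⟩ := hx
  exact hr

theorem vouched_nil (h : List S → Bool) (T : List (List S)) : Vouched h T [] := by
  intro l h1 h2
  rw [List.length_nil] at h2
  lia

theorem prob_incorrect_le (D : PMF X) (P : Fin k → Prover X S) (h : Verifier X S)
    (hist : History X S) :
    prob ((searchProver V L js hist).jointLaw P D)
        {z | ∃ τ, z.2 = some τ ∧ ¬ CorrectTrace h z.1 τ} ≤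
      prob (searchLaw V L js D P hist) (mistakeEvent V L h hist true) := by
  rw [jointLaw_searchProver, prob_map]
  refine prob_mono_support fun ω hω => ?_
  rintro ⟨τ, hτ, hbad⟩
  exact ((ProverProgram.allOutputs_search_correct _ ω.1 js h L [] [] (vouched_nil _ _)
    (by simp)).of_mem_support (mem_support_searchLaw hω) τ hτ).resolve_left hbad

/-- Giving up is covered by four events: the problem is not good, a mistake of either kind, or a
layer without a correct sample. False acceptances count because they can lead the search to a trace
where goodness promises nothing. -/
theorem prob_none_le {N : ℕ} {D : PMF X} {P : Fin k → Prover X S} {h : Verifier X S}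
    {α γ : ℝ} (hα1 : α ≤ 1) (hgood : GoodFor P h L α γ D) (hjs : ∀ j, js.count j = N)
    (hist : History X S) :
    prob ((searchProver V L js hist).jointLaw P D) {z | z.2 = none} ≤
      (1 - γ) + prob (searchLaw V L js D P hist) (mistakeEvent V L h hist false) +
        prob (searchLaw V L js D P hist) (mistakeEvent V L h hist true) + L * (1 - α) ^ N := by
  rw [jointLaw_searchProver, prob_map]
  set p := searchLaw V L js D P hist with hp
  set G := {x | GoodOn P h L α x}
  set A : Set (X × (List (List S) × Option (List S))) := Prod.fst ⁻¹' Gᶜ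
  set E : Set (X × (List (List S) × Option (List S))) := {ω | ω.1 ∈ G ∧ ω.2.2 = none ∧
    ∀ b, ¬ ∃ σ, Mistake L (verdict V hist ω.1) (h ω.1) ω.2.1 b σ}
  have hA : prob p A ≤ 1 - γ := by
    have : p.map Prod.fst = D := by
      simp only [hp, searchLaw, ← PMF.bind_pure_comp, PMF.bind_bind,
        PMF.pure_bind, Function.comp_def, PMF.bind_const, PMF.bind_pure]
    rw [← prob_map, this, prob_compl]
    have : γ ≤ prob D G := hgood
    linarith
  have hE : prob p E ≤ L * (1 - α) ^ N := by
    have hnn : (0 : ℝ) ≤ (1 - α) ^ N := pow_nonneg (by linarith) N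
    refine ENNReal.toReal_le_of_le_ofReal (by positivity) ?_
    rw [hp, searchLaw, toOuterMeasure_bind, ← expect_const D (ENNReal.ofReal _)]
    refine expect_mono fun x => ?_
    rw [PMF.toOuterMeasure_map_apply, ENNReal.ofReal_mul (Nat.cast_nonneg L),
      ENNReal.ofReal_natCast]
    by_cases hx : x ∈ G
    · refine le_trans (PMF.toOuterMeasure_mono _ fun r hr => hr.1.2)
        (ProverProgram.search_none_le _ x js hα1 hx hjs L [] [] (vouched_nil _ _) ?_ (by simp))
      intro n hn
      simp at hn
    · rw [toOuterMeasure_eq_zero fun r _ hr => hx hr.1]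
      exact zero_le
  have hsub : (fun ω : X × (List (List S) × Option (List S)) => (ω.1, ω.2.2)) ⁻¹'
      {z | z.2 = none} ⊆ ((A ∪ mistakeEvent V L h hist false) ∪ mistakeEvent V L h hist true) ∪ E := by
    intro ω hω
    by_contra hn
    simp only [Set.mem_union, not_or] at hn
    obtain ⟨⟨⟨h1, h2⟩, h3⟩, h4⟩ := hn
    refine h4 ⟨not_not.1 h1, hω, fun b => ?_⟩
    cases b
    · exact h2
    · exact h3
  refine (prob_mono_support fun ω _ hω => hsub hω).trans ?_
  have e1 := prob_union_le p ((A ∪ mistakeEvent V L h hist false) ∪ mistakeEvent V L h hist true) E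
  have e2 := prob_union_le p (A ∪ mistakeEvent V L h hist false) (mistakeEvent V L h hist true)
  have e3 := prob_union_le p A (mistakeEvent V L h hist false)
  linarith

end SearchProver

/-! ### Choice of sample sizes. -/

/-- `N` copies of each of the `k` provers. -/
def proverList (k N : ℕ) : List (Fin k) := (List.replicate N (List.finRange k)).flatten

theorem count_proverList {k : ℕ} (N : ℕ) (j : Fin k) : (proverList k N).count j = N := by
  simp [proverList, List.count_flatten, List.map_replicate, List.sum_replicate,
    List.count_eq_one_of_mem (List.nodup_finRange k) (List.mem_finRange j)]

theorem length_proverList (k N : ℕ) : (proverList k N).length = N * k := by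
  simp [proverList, List.length_flatten, List.map_replicate, List.sum_replicate]

theorem one_le_logO (t : ℝ) : 1 ≤ logO t := le_max_left _ _

theorem log_le_logO (t : ℝ) : Real.log t ≤ logO t := le_max_right _ _

theorem log_mul_le_logO {c t : ℝ} (hc : 0 < c) (ht : 0 < t) {n : ℕ} (hn : c ≤ 2 ^ n) :
    Real.log (c * t) ≤ (n + 1) * logO t := by
  rw [Real.log_mul hc.ne' ht.ne']
  have h1 : Real.log c ≤ n * Real.log 2 := by
    rw [← Real.log_pow]
    exact Real.log_le_log hc hn
  have h2 := Real.log_two_lt_d9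
  have h3 := one_le_logO t
  have h4 := log_le_logO t
  have h5 : (0 : ℝ) ≤ n := n.cast_nonneg
  nlinarith

theorem exp_neg_le {w : ℝ} (h0 : 0 ≤ w) (h1 : w ≤ 1) : Real.exp (-w) ≤ 1 - w / 2 := by
  rw [Real.exp_neg, inv_le_comm₀ (Real.exp_pos w) (by linarith), inv_le_iff_one_le_mul₀' (by linarith)]
  nlinarith [Real.add_one_le_exp w]

/-- Enough samples per prover and layer for a search of `L` layers. -/
theorem exists_sample_size {L k : ℕ} (hL : 0 < L) (hk : 0 < k) {α ε' : ℝ} (hα0 : 0 < α)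
    (hα1 : α ≤ 1) (hε0 : 0 < ε') :
    ∃ N : ℕ, L * (1 - α) ^ N ≤ ε' ∧ (N : ℝ) ≤ 2 * logO (L * k / ε') / α := by
  have hL' : (1 : ℝ) ≤ L := by exact_mod_cast hL
  have hk' : (1 : ℝ) ≤ k := by exact_mod_cast hk
  set ℓ := logO ((L : ℝ) * k / ε')
  have hℓ : 1 ≤ ℓ := one_le_logO _
  have hlog : Real.log (L / ε') ≤ ℓ := by
    refine le_trans (Real.log_le_log (by positivity) ?_) (log_le_logO _)
    gcongr
    nlinarith
  refine ⟨⌈ℓ / α⌉₊, ?_, ?_⟩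
  · have h1 : (1 - α) ^ ⌈ℓ / α⌉₊ ≤ ε' / L := by
      calc (1 - α) ^ ⌈ℓ / α⌉₊ ≤ Real.exp (-α) ^ ⌈ℓ / α⌉₊ := by
            refine pow_le_pow_left₀ (by linarith) ?_ _
            linarith [Real.add_one_le_exp (-α)]
        _ = Real.exp (-(⌈ℓ / α⌉₊ * α)) := by
            rw [← Real.exp_nat_mul]
            ring_nf
        _ ≤ Real.exp (-Real.log (L / ε')) := by
            gcongr
            exact hlog.trans ((div_le_iff₀ hα0).1 (Nat.le_ceil _))
        _ = ε' / L := by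
            rw [Real.exp_neg, Real.exp_log (by positivity), inv_div]
    calc (L : ℝ) * (1 - α) ^ ⌈ℓ / α⌉₊ ≤ L * (ε' / L) := by gcongr
      _ = ε' := by field_simp
  -- The ceiling costs only a factor two because `ℓ ≥ 1` and `α ≤ 1`.
  · have h2 : 1 ≤ ℓ / α := by
      rw [le_div_iff₀ hα0]
      linarith
    have := (Nat.ceil_lt_add_one (zero_le_one.trans h2)).le
    rw [mul_div_assoc]
    linarith

/-- Sizes of the training and of the validation phase. -/
theorem exists_phase_sizes {M ε δ μ κ : ℝ} (hM : 1 ≤ M) (hε0 : 0 < ε) (hε1 : ε < 1)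
    (hδ0 : 0 < δ) (hμ : 1 ≤ μ) (hκ : M / μ ≤ 2 * κ) :
    ∃ n₁ n₂ : ℕ,
      Real.exp (2 * μ) * Real.exp (-(n₁ * (μ * ε / (8 * M)))) ≤ δ / 2 ∧
      (M + 1) * (2 * Real.exp (-(n₂ * (ε * μ / M) / 16))) ≤ δ / 2 ∧
      (n₁ : ℝ) ≤ 17 * (M / ε) + 32 * (κ * logO (M / δ) / ε) ∧
      (n₂ : ℝ) ≤ M / ε + 128 * (κ * logO (M / δ) / ε) ∧
      (n₂ : ℝ) ≤ 1 + 128 * (κ * logO (M / δ) / ε) := by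
  set ℓ := logO (M / δ)
  have hℓ : 1 ≤ ℓ := one_le_logO _
  have hMε : 1 ≤ M / ε := by
    rw [le_div_iff₀ hε0]
    linarith
  have hM0 : 0 < M := by linarith
  have hμ0 : 0 < μ := by linarith
  have hκ0 : 0 ≤ κ := by
    have : 0 ≤ M / μ := by positivity
    linarith
  have hlog1 : Real.log (2 / δ) ≤ 2 * ℓ := by
    have h1 := log_mul_le_logO (c := 2) (t := M / δ) (n := 1) (by norm_num) (by positivity)
      (by norm_num)
    have h2 : Real.log (2 / δ) ≤ Real.log (2 * (M / δ)) := by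
      refine Real.log_le_log (by positivity) ?_
      rw [← mul_div_assoc]
      gcongr
      linarith
    norm_num at h1
    linarith
  have hlog2 : Real.log (4 * (M + 1) / δ) ≤ 4 * ℓ := by
    have h1 := log_mul_le_logO (c := 8) (t := M / δ) (n := 3) (by norm_num) (by positivity)
      (by norm_num)
    have h2 : Real.log (4 * (M + 1) / δ) ≤ Real.log (8 * (M / δ)) := by
      refine Real.log_le_log (by positivity) ?_
      rw [← mul_div_assoc]
      exact div_le_div_of_nonneg_right (by linarith) hδ0.le
    norm_num at h1
    linarith
  -- Solves `a * (με / (8M)) = 2μ + 2ℓ`: the `2μ` cancels the initial potential and the `2ℓ` covers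
  -- `log (2 / δ)`.
  set a := (2 * μ + 2 * ℓ) * (8 * M / (μ * ε)) with ha
  -- Solves `b * (εμ / M) / 16 = 4ℓ`, which covers the union bound's `log (4(M + 1) / δ)`.
  set b := 4 * ℓ * (16 * M / (ε * μ)) with hb
  have ha0 : 0 ≤ a := by positivity
  have hb0 : 0 ≤ b := by positivity
  have ha' : a ≤ 16 * (M / ε) + 32 * (κ * ℓ / ε) := by
    have : a = 16 * (M / ε) + 16 * (M / μ * ℓ / ε) := by
      rw [ha]
      field_simp
      ring
    rw [this]
    have : M / μ * ℓ / ε ≤ 2 * κ * ℓ / ε := by gcongr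
    have e : 2 * κ * ℓ / ε = 2 * (κ * ℓ / ε) := by ring
    linarith
  have hb' : b ≤ 128 * (κ * ℓ / ε) := by
    have : b = 64 * (M / μ * ℓ / ε) := by
      rw [hb]
      field_simp
      ring
    rw [this]
    have : M / μ * ℓ / ε ≤ 2 * κ * ℓ / ε := by gcongr
    have e : 2 * κ * ℓ / ε = 2 * (κ * ℓ / ε) := by ring
    linarith
  have hca := (Nat.ceil_lt_add_one ha0).le
  have hcb := (Nat.ceil_lt_add_one hb0).le
  refine ⟨⌈a⌉₊, ⌈b⌉₊, ?_, ?_, by linarith, by linarith, by linarith⟩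
  · rw [← Real.exp_add]
    have h1 : 2 * μ + 2 * ℓ ≤ ⌈a⌉₊ * (μ * ε / (8 * M)) := by
      calc 2 * μ + 2 * ℓ = a * (μ * ε / (8 * M)) := by
            rw [ha]
            field_simp
        _ ≤ _ := by
            gcongr
            exact Nat.le_ceil a
    calc _ ≤ Real.exp (-Real.log (2 / δ)) := Real.exp_le_exp.2 (by linarith)
      _ = δ / 2 := by rw [Real.exp_neg, Real.exp_log (by positivity), inv_div]
  · have h1 : 4 * ℓ ≤ ⌈b⌉₊ * (ε * μ / M) / 16 := by
      calc 4 * ℓ = b * (ε * μ / M) / 16 := by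
            rw [hb]
            field_simp
        _ ≤ _ := by
            gcongr
            exact Nat.le_ceil b
    calc _ ≤ (M + 1) * (2 * Real.exp (-Real.log (4 * (M + 1) / δ))) := by
          gcongr
          linarith
      _ = δ / 2 := by
          rw [Real.exp_neg, Real.exp_log (by positivity), inv_div]
          field_simp
          norm_num

/-! ### Assembly of the learning procedure. -/

/-- What the theorem asks of the learned prover `W`. -/
def Succeeds (P : Fin k → Prover X S) (D : PMF X) (h : Verifier X S) (L Ms Mc : ℕ)
    (ε ε' γ : ℝ) : Set (AssistedProver X S k) :=
  {W | (∀ x, ∀ o ∈ ((W x).law P).support, o = none ∨ ∃ τ : List S, τ.length = L ∧ o = some τ) ∧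
    prob (W.jointLaw P D) {z | z.2 = none} ≤
      (1 - γ) + ε * Mc / (Mc + Ms) + ε * Ms / (Mc + Ms) + ε' ∧
    prob (W.jointLaw P D) {z | ∃ τ, z.2 = some τ ∧ ¬ CorrectTrace h z.1 τ} ≤ ε * Ms / (Mc + Ms)}

/-- The `max 1` in the hypothesis is harmless: for a zero budget it allows a positive probability,
but mistakes of that kind then never occur after an error history. -/
theorem searchProver_succeeds {V : OnlineVerifier X S} {L N Ms Mc : ℕ} {js : List (Fin k)}
    {H : Set (Verifier X S)} (hV : HasMistakeBounds V H L Ms Mc) {h : Verifier X S} (hH : h ∈ H)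
    {P : Fin k → Prover X S} {D : PMF X} {α γ ε ε' : ℝ} (hα1 : α ≤ 1)
    (hgood : GoodFor P h L α γ D) (hjs : ∀ j, js.count j = N) (hN : L * (1 - α) ^ N ≤ ε')
    {g : History X S} (herr : ErrorHistory V h L g)
    (hg : ∀ b, prob (searchLaw V L js D P g) (mistakeEvent V L h g b) ≤
      ε * max 1 (mistakeBound Ms Mc b : ℝ) / ((Ms : ℝ) + Mc)) :
    searchProver V L js g ∈ Succeeds P D h L Ms Mc ε ε' γ := by
  have hq : ∀ b, prob (searchLaw V L js D P g) (mistakeEvent V L h g b) ≤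
      ε * mistakeBound Ms Mc b / ((Mc : ℝ) + Ms) := by
    intro b
    rcases Nat.eq_zero_or_pos (mistakeBound Ms Mc b) with h0 | h0
    · rw [prob_mistakeEvent_eq_zero hV hH herr h0, h0]
      simp
    · have h1 : max 1 (mistakeBound Ms Mc b : ℝ) = mistakeBound Ms Mc b :=
        max_eq_right (by exact_mod_cast h0)
      have h2 := hg b
      rwa [h1, add_comm (Ms : ℝ)] at h2
  have hqt : _ ≤ ε * Ms / ((Mc : ℝ) + Ms) := hq true
  have hqf : _ ≤ ε * Mc / ((Mc : ℝ) + Ms) := hq false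
  refine ⟨fun x o ho => searchProver_output ho, ?_, (prob_incorrect_le D P h g).trans hqt⟩
  have := prob_none_le (V := V) hα1 hgood hjs g
  linarith

/-- The learning procedure of the theorem. -/
noncomputable def learnProver (V : OnlineVerifier X S) (L : ℕ) (js : List (Fin k)) (p : Bool)
    (t : Bool → ℝ) (M n₁ n₂ : ℕ) : Learner X S k (AssistedProver X S k) :=
  (Learner.learnHistory V L js p t M n₁ n₂).bind fun g => .output (searchProver V L js g)

theorem law_learnProver (D : PMF X) (P : Fin k → Prover X S) (h : Verifier X S)
    (V : OnlineVerifier X S) (L : ℕ) (js : List (Fin k)) (p : Bool) (t : Bool → ℝ)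
    (M n₁ n₂ : ℕ) : (learnProver V L js p t M n₁ n₂).law D P h =
      ((Learner.learnHistory V L js p t M n₁ n₂).law D P h).map (searchProver V L js) := by
  rw [learnProver, Learner.law_bind, ← PMF.bind_pure_comp]
  rfl

theorem learnProver_succeeds {V : OnlineVerifier X S} {L N Ms Mc : ℕ} {js : List (Fin k)}
    {H : Set (Verifier X S)} (hV : HasMistakeBounds V H L Ms Mc) {h : Verifier X S} (hH : h ∈ H)
    {P : Fin k → Prover X S} {D : PMF X} {α γ ε ε' δ : ℝ} (hα1 : α ≤ 1)
    (hgood : GoodFor P h L α γ D) (hjs : ∀ j, js.count j = N) (hN : L * (1 - α) ^ N ≤ ε')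
    {p : Bool} {t : Bool → ℝ} {M n₁ n₂ : ℕ}
    (hbad : prob ((Learner.learnHistory V L js p t M n₁ n₂).law D P h)
      {g | ∃ b, ε * max 1 (mistakeBound Ms Mc b : ℝ) / ((Ms : ℝ) + Mc) <
        prob (searchLaw V L js D P g) (mistakeEvent V L h g b)} ≤ δ) :
    1 - δ ≤ prob ((learnProver V L js p t M n₁ n₂).law D P h)
      (Succeeds P D h L Ms Mc ε ε' γ) := by
  rw [law_learnProver, prob_map]
  refine le_trans (sub_le_sub_left hbad 1) ?_
  rw [← prob_compl]
  refine prob_mono_support fun g hg hgbad => ?_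
  exact searchProver_succeeds hV hH hα1 hgood hjs hN
    (Learner.errorHistory_of_mem_support_learnHistory hg)
    fun b => not_lt.1 fun hlt => hgbad ⟨b, hlt⟩

theorem potential_nil_le {w B : Bool → ℝ} {M : Bool → ℕ} {μ : ℝ} (hw : ∀ b, 0 ≤ w b)
    (hMB : ∀ b, (M b : ℝ) ≤ B b) (hμ : ∀ b, w b * B b = μ) :
    potential w M ([] : History X S) ≤ Real.exp (2 * μ) := by
  have h1 : ∀ b, w b * ((M b : ℝ) - errorCount b ([] : History X S)) ≤ μ := fun b => by
    rw [← hμ b]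
    exact mul_le_mul_of_nonneg_left (by simpa [errorCount] using hMB b) (hw b)
  refine Real.exp_le_exp.2 ?_
  linarith [h1 true, h1 false]

theorem prob_learnHistory_failure_le {V : OnlineVerifier X S} {L Ms Mc : ℕ} {js : List (Fin k)}
    {H : Set (Verifier X S)} (hV : HasMistakeBounds V H L Ms Mc) {h : Verifier X S} (hH : h ∈ H)
    (D : PMF X) (P : Fin k → Prover X S) {ε δ μ : ℝ} {B : Bool → ℝ} {p : Bool} {n₁ n₂ : ℕ}
    (hM : 1 ≤ (Ms : ℝ) + Mc) (hε0 : 0 < ε) (hε1 : ε < 1) (hδ0 : 0 < δ) (hμ1 : 1 ≤ μ)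
    (hμB : ∀ b, μ ≤ B b) (hμM : μ ≤ (Ms : ℝ) + Mc)
    (hBM : ∀ b, (mistakeBound Ms Mc b : ℝ) ≤ B b) (hp : B p ≤ B (!p))
    (hn1 : Real.exp (2 * μ) * Real.exp (-(n₁ * (μ * ε / (8 * ((Ms : ℝ) + Mc))))) ≤ δ / 2)
    (hn2 : ((Ms : ℝ) + Mc + 1) * (2 * Real.exp (-(n₂ * (ε * μ / ((Ms : ℝ) + Mc)) / 16))) ≤
      δ / 2) :
    prob ((Learner.learnHistory V L js p (fun b => n₂ * (ε * B b / ((Ms : ℝ) + Mc)) / 2)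
        (Ms + Mc) n₁ n₂).law D P h)
      {g | ∃ b, ε * B b / ((Ms : ℝ) + Mc) <
        prob (searchLaw V L js D P g) (mistakeEvent V L h g b)} ≤ δ := by
  set M : ℝ := (Ms : ℝ) + Mc with hMdef
  set θ : Bool → ℝ := fun b => ε * B b / M with hθdef
  have hM0 : 0 < M := by linarith
  have hμ0 : 0 < μ := by linarith
  set w : Bool → ℝ := fun b => μ / B b with hwdef
  have hB0 : ∀ b, 0 < B b := fun b => hμ0.trans_le (hμB b)
  have hw0 : ∀ b, 0 ≤ w b := fun b => div_nonneg hμ0.le (hB0 b).le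
  have hw1 : ∀ b, w b ≤ 1 := fun b => (div_le_one (hB0 b)).2 (hμB b)
  have hwp : w (!p) ≤ w p := div_le_div_of_nonneg_left hμ0.le (hB0 p) hp
  have hθ0 : ∀ b, 0 ≤ θ b := fun b => div_nonneg (mul_nonneg hε0.le (hB0 b).le) hM0.le
  set ρ : ℝ := 1 - μ * ε / (8 * M) with hρdef
  have hρ0 : 0 ≤ ρ := by
    rw [hρdef, sub_nonneg, div_le_one (by positivity)]
    nlinarith
  have hρ : ∀ b, 1 + (Real.exp (-w b) - 1) * (θ b / 4) ≤ ρ := by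
    intro b
    have h1 := exp_neg_le (hw0 b) (hw1 b)
    -- The weights are inverse to `B b` and the thresholds proportional to it, so one rate `ρ`
    -- serves both kinds.
    have h2 : w b / 2 * (θ b / 4) = μ * ε / (8 * M) := by
      have := (hB0 b).ne'
      simp only [hwdef, hθdef]
      field_simp
      norm_num
    have h3 := hθ0 b
    rw [hρdef, ← h2]
    nlinarith
  have hη : ∀ b, Real.exp (-(n₂ * θ b / 16)) ≤ Real.exp (-(n₂ * (ε * μ / M) / 16)) := by
    intro b
    have : ε * μ / M ≤ θ b :=
      div_le_div_of_nonneg_right (mul_le_mul_of_nonneg_left (hμB b) hε0.le) hM0.le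
    gcongr
  have hpot : potential w (mistakeBound Ms Mc) ([] : History X S) ≤ Real.exp (2 * μ) :=
    potential_nil_le hw0 hBM fun b => div_mul_cancel₀ _ (hB0 b).ne'
  have hfail := Learner.learnHistory_failure_le (js := js) hV hH D P hw0 hwp hθ0 hρ0 hρ n₁ n₂
    (Real.exp_pos _).le hη
  refine ENNReal.toReal_le_of_le_ofReal hδ0.le (hfail.trans (ENNReal.ofReal_le_ofReal ?_))
  have h1 : ρ ^ n₁ ≤ Real.exp (-(n₁ * (μ * ε / (8 * M)))) := by
    calc ρ ^ n₁ ≤ Real.exp (-(μ * ε / (8 * M))) ^ n₁ := by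
          gcongr
          linarith [Real.add_one_le_exp (-(μ * ε / (8 * M)))]
      _ = _ := by
          rw [← Real.exp_nat_mul]
          ring_nf
  have h2 : potential w (mistakeBound Ms Mc) ([] : History X S) * ρ ^ n₁ ≤
      Real.exp (2 * μ) * Real.exp (-(n₁ * (μ * ε / (8 * M)))) := by gcongr
  linarith

end CoTVerification

open CoTVerification in
theorem mainTheorem5 :
    ∃ C : ℝ, 0 < C ∧
      ∀ (X : Type u) (S : Type v) (L k Ms Mc : ℕ)
        (H : Set (CoTVerification.Verifier X S)) (V : CoTVerification.OnlineVerifier X S)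
        (α ε ε' δ : ℝ),
        0 < L → 0 < k → 0 < Ms + Mc →
        0 < α → α ≤ 1 → 0 < ε → ε < 1 → 0 < ε' → ε' < 1 → 0 < δ → δ < 1 →
        CoTVerification.HasMistakeBounds V H L Ms Mc →
        ∃ (A : CoTVerification.Learner X S k (CoTVerification.AssistedProver X S k)) (m q : ℕ),
          A.DrawsAtMost m ∧
          A.QueriesAtMost q ∧
          (m : ℝ) ≤ C * (((Ms : ℝ) + Mc) / ε +
            1 / ε * (((Ms : ℝ) + Mc) / (min (Ms : ℝ) Mc + 1)) *
              CoTVerification.logO (((Ms : ℝ) + Mc) / δ)) ∧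
          (q : ℝ) ≤ C * ((((Ms : ℝ) + Mc) / ε) * (((Ms : ℝ) + Mc) / (min (Ms : ℝ) Mc + 1)) *
            CoTVerification.logO (((Ms : ℝ) + Mc) / δ) *
            ((L : ℝ) * k / α * CoTVerification.logO ((L : ℝ) * k / ε'))) ∧
          ∀ (D : PMF X) (P : Fin k → CoTVerification.Prover X S), ∀ h ∈ H, ∀ γ : ℝ,
            CoTVerification.GoodFor P h L α γ D →
            1 - δ ≤ CoTVerification.prob (A.law D P h)
              {W : CoTVerification.AssistedProver X S k |
                (∀ x, ∀ o ∈ ((W x).law P).support,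
                  o = none ∨ ∃ τ : List S, τ.length = L ∧ o = some τ) ∧
                CoTVerification.prob (W.jointLaw P D) {z | z.2 = none} ≤
                  (1 - γ) + ε * Mc / (Mc + Ms) + ε * Ms / (Mc + Ms) + ε' ∧
                CoTVerification.prob (W.jointLaw P D)
                    {z | ∃ τ, z.2 = some τ ∧ ¬ CoTVerification.CorrectTrace h z.1 τ} ≤
                  ε * Ms / (Mc + Ms)} := by
  -- The oracle calls decide: a factor `500` from the phase sizes times `2` from the number of
  -- samples per prover.
  refine ⟨1000, by norm_num, ?_⟩
  intro X S L k Ms Mc H V α ε ε' δ hL hk hpos hα0 hα1 hε0 hε1 hε'0 hε'1 hδ0 hδ1 hV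
  set M : ℝ := (Ms : ℝ) + Mc with hMdef
  have hM : 1 ≤ M := by
    rw [hMdef]
    exact_mod_cast hpos
  have hM0 : 0 < M := by linarith
  have hs0 : (0 : ℝ) ≤ Ms := Ms.cast_nonneg
  have hc0 : (0 : ℝ) ≤ Mc := Mc.cast_nonneg
  set κ := M / (min (Ms : ℝ) Mc + 1) with hκdef
  have hmin0 : 0 ≤ min (Ms : ℝ) Mc := le_min hs0 hc0
  have hκ1 : 1 ≤ κ := by
    rw [hκdef, one_le_div (by linarith)]
    rcases Nat.eq_zero_or_pos Ms with h0 | h0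
    · simpa [h0] using hM
    rcases Nat.eq_zero_or_pos Mc with h1 | h1
    · simpa [h1] using hM
    have h2 : (1 : ℝ) ≤ Ms := by exact_mod_cast h0
    have h3 : (1 : ℝ) ≤ Mc := by exact_mod_cast h1
    rcases min_choice (Ms : ℝ) Mc with h | h <;> rw [h] <;> linarith
  -- Truncation at one keeps thresholds positive and weights finite when a budget vanishes.
  set B : Bool → ℝ := fun b => max 1 (mistakeBound Ms Mc b : ℝ) with hB
  have hB1 : ∀ b, 1 ≤ B b := fun b => le_max_left _ _
  have hBM : ∀ b, (mistakeBound Ms Mc b : ℝ) ≤ B b := fun b => le_max_right _ _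
  set μ := min (B true) (B false) with hμdef
  have hμB : ∀ b, μ ≤ B b := by
    rintro (_ | _)
    · exact min_le_right _ _
    · exact min_le_left _ _
  have hμ1 : 1 ≤ μ := le_min (hB1 _) (hB1 _)
  have hμ0 : 0 < μ := by linarith
  have hμmin : min (Ms : ℝ) Mc ≤ μ := min_le_min (hBM true) (hBM false)
  have hμM : μ ≤ M := by
    refine (hμB true).trans (max_le hM ?_)
    change (Ms : ℝ) ≤ M
    linarith
  -- This is `min Ms Mc + 1 ≤ 2 * μ`, as `μ` is at least both `1` and the minimum.
  have hκμ : M / μ ≤ 2 * κ := by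
    rw [hκdef, ← mul_div_assoc, div_le_div_iff₀ hμ0 (by linarith)]
    nlinarith
  -- The preferred kind has the smaller budget, hence the larger weight.
  obtain ⟨p, hp⟩ : ∃ p : Bool, B p ≤ B (!p) := by
    rcases le_total (B true) (B false) with h | h
    · exact ⟨true, h⟩
    · exact ⟨false, h⟩
  obtain ⟨N, hN1, hN2⟩ := exists_sample_size hL hk hα0 hα1 hε'0
  obtain ⟨n₁, n₂, hn1, hn2, hb1, hb2, hb2'⟩ :=
    exists_phase_sizes hM hε0 hε1 hδ0 hμ1 hκμ
  set ℓ := logO (M / δ)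
  have hℓ : 1 ≤ ℓ := one_le_logO _
  set θ : Bool → ℝ := fun b => ε * B b / M with hθdef
  set js := proverList k N
  have hMε : 1 ≤ M / ε := by
    rw [le_div_iff₀ hε0]
    linarith
  refine ⟨learnProver V L js p (fun b => n₂ * θ b / 2) (Ms + Mc) n₁ n₂, n₁ + n₂,
    n₁ * (L * js.length) + (Ms + Mc + 1) * (n₂ * (L * js.length)), ?_, ?_, ?_, ?_, ?_⟩
  · exact (Learner.drawsAtMost_learnHistory _ _ _ _ _).bind (n := 0) fun _ => trivial
  · exact (Learner.queriesAtMost_learnHistory _ _ _ _ _).bind (n := 0) fun _ => trivial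
  · push_cast
    have e : 1 / ε * κ * ℓ = κ * ℓ / ε := by ring
    rw [e]
    have : 0 ≤ κ * ℓ / ε := by positivity
    linarith
  · rw [length_proverList]
    push_cast
    set lam := logO ((L : ℝ) * k / ε')
    have hlam : 1 ≤ lam := one_le_logO _
    have hQ : (L : ℝ) * (N * k) ≤ 2 * (L * k / α * lam) := by
      calc (L : ℝ) * (N * k) ≤ L * (2 * lam / α * k) := by gcongr
        _ = _ := by ring
    have hZ : 1 ≤ κ * ℓ := one_le_mul_of_one_le_of_one_le hκ1 hℓ
    have hZε : κ * ℓ / ε ≤ M / ε * κ * ℓ := by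
      have : M / ε * κ * ℓ = M * (κ * ℓ / ε) := by ring
      rw [this]
      have : 0 ≤ κ * ℓ / ε := by positivity
      nlinarith
    have hMZ : M / ε ≤ M / ε * κ * ℓ := by
      rw [mul_assoc]
      exact le_mul_of_one_le_right (by linarith) hZ
    -- Here the ceiling in `n₂` must be absorbed as `1`, not as `M / ε`, since it is multiplied by
    -- `M + 1`.
    have hMn : (M + 1) * n₂ ≤ 258 * (M / ε * κ * ℓ) := by
      have h1 : 1 ≤ κ * ℓ / ε := by
        rw [le_div_iff₀ hε0]
        linarith
      calc (M + 1) * (n₂ : ℝ) ≤ (2 * M) * (129 * (κ * ℓ / ε)) := by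
            gcongr
            · linarith
            · linarith
        _ = _ := by ring
    have htot : (n₁ : ℝ) + (M + 1) * n₂ ≤ 500 * (M / ε * κ * ℓ) := by linarith
    calc _ = ((n₁ : ℝ) + (M + 1) * n₂) * (L * (N * k)) := by rw [hMdef]; ring
      _ ≤ (500 * (M / ε * κ * ℓ)) * (2 * (L * k / α * lam)) := by gcongr
      _ = _ := by ring
  · intro D P h hH γ hgood
    refine learnProver_succeeds hV hH hα1 hgood (count_proverList N) hN1 ?_
    exact prob_learnHistory_failure_le hV hH D P hM hε0 hε1 hδ0 hμ1 hμB hμM hBM hp hn1 hn2
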